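/- Let $d\ge 1$ be an integer. Then there exist constants $c_1,c_2$, depending only on $d$, such that for every integer $r\ge d+2$ and every finite set $C\subset\mathbb{R}^d$ with $|C|\ge r$, the set $C$ has a weak $r$-division with respect to $c_1,c_2$. Here, for a finite set $S\subset\mathbb{R}^d$ and $p\in S$, the Voronoi cell of $p$ in the Voronoi diagram of $S$ is $\{x\in\mathbb{R}^d : \|x-p\|\le\|x-q\| \text{ for all } q\in S\}$, where $\|\cdot\|$ is the Euclidean norm. A set $Z$ is a Voronoi separator for $C_1$ and $C_2$ if, in the Voronoi diagram of $C_1\cup C_2\cup Z$, the topological boundary of the cell of each point of $C_1$ is disjoint from the topological boundary of the cell of each point of $C_2$. A weak $r$-division of $C$ with respect to $c_1,c_2$ is a finite set $Z\subset\mathbb{R}^d$ (the boundary points) together with a finite collection $\mathcal R$ of subsets of $C\cup Z$ (the regions) such that 1. the sets $R\setminus Z$, $R\in\mathcal R$, are nonempty and pairwise disjoint, and their union is $C$; 2. $|\mathcal R|\le c_1|C|/r$; 3. $|R|\le r$ for every $R\in\mathcal R$; 4. $\sum_{R\in\mathcal R}|R\cap Z|\le c_2|C|/r^{1/d}$; 5.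 for every $R\in\mathcal R$, the set $R\cap Z$ is a Voronoi separator for $R\setminus Z$ and $(C\cup Z)\setminus R$. -/

import Mathlib

/-- The closed Voronoi cell of the site `p` in the Voronoi diagram of the set of sites `S`. -/
def voronoiCell {d : ℕ} (S : Set (EuclideanSpace ℝ (Fin d))) (p : EuclideanSpace ℝ (Fin d)) :
    Set (EuclideanSpace ℝ (Fin d)) :=
  {x | ∀ q ∈ S, dist x p ≤ dist x q}

/-- `Z` is a Voronoi separator for `C₁` and `C₂`: in the Voronoi diagram of `C₁ ∪ C₂ ∪ Z`, the
boundaries of the cells of points of `C₁` are disjoint from those of cells of points of `C₂`. -/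
def IsVoronoiSeparator {d : ℕ} (Z C₁ C₂ : Set (EuclideanSpace ℝ (Fin d))) : Prop :=
  ∀ p ∈ C₁, ∀ q ∈ C₂,
    Disjoint (frontier (voronoiCell (C₁ ∪ C₂ ∪ Z) p)) (frontier (voronoiCell (C₁ ∪ C₂ ∪ Z) q))

open Classical in
/-- The set `Z` of boundary points together with the collection `𝓡` of regions is a weak
`r`-division, with respect to the constants `c₁` and `c₂`, of the finite point set `C`. -/
structure IsWeakRDivision {d : ℕ} (c₁ c₂ : ℝ) (r : ℕ) (C Z : Finset (EuclideanSpace ℝ (Fin d)))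
    (𝓡 : Finset (Finset (EuclideanSpace ℝ (Fin d)))) : Prop where
  /-- Regions are subsets of `C ∪ Z`. -/
  subset : ∀ R ∈ 𝓡, R ⊆ C ∪ Z
  /-- The sets `R \ Z`, for `R` a region, are the parts of a partition of `C`. -/
  nonempty : ∀ R ∈ 𝓡, (R \ Z).Nonempty
  disjoint : ∀ R ∈ 𝓡, ∀ R' ∈ 𝓡, R ≠ R' → Disjoint (R \ Z) (R' \ Z)
  union : 𝓡.biUnion (fun R => R \ Z) = C
  /-- There are at most `c₁ |C| / r` regions. -/
  card_regions : (𝓡.card : ℝ) ≤ c₁ * (C.card : ℝ) / (r : ℝ)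
  /-- Each region contains at most `r` points. -/
  card_region : ∀ R ∈ 𝓡, R.card ≤ r
  /-- The number of boundary points, summed over all regions, is at most `c₂ |C| / r ^ (1 / d)`. -/
  card_boundary :
    ((∑ R ∈ 𝓡, (R ∩ Z).card : ℕ) : ℝ) ≤ c₂ * (C.card : ℝ) / (r : ℝ) ^ ((1 : ℝ) / (d : ℝ))
  /-- The boundary points of a region separate its other points from everything outside it. -/
  separator : ∀ R ∈ 𝓡,
    IsVoronoiSeparator ((R ∩ Z : Finset _) : Set (EuclideanSpace ℝ (Fin d)))
      ((R \ Z : Finset _) : Set (EuclideanSpace ℝ (Fin d)))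
      (((C ∪ Z) \ R : Finset _) : Set (EuclideanSpace ℝ (Fin d)))

/-! Carve the space into pieces by cutting along spheres, one after another. At each time let A
consist of the points of C not yet carved out and the additional points still in play. Among the
balls centred at points of A that contain at least m points of A, where m is a small fraction of r
depending on d, take one of least radius ρ, and carve out a concentric ball of radius t in (ρ, 2ρ].

Additional points are placed on the sphere with respect to a local scale H: a 1-Lipschitz function
that vanishes on the original points left and is at least the distance to A. On the part of the
sphere not carved away before, take a maximal set N that is H/100-separated, also from the old
additional points. By maximality every uncovered y on the sphere has an additional point within
H(y)/50. But H(y) ≤ dist(y, p) for each original point p left, so the cell of p cannot cross the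
sphere: this separates the pieces (`IsCarving.mem_of_nearest`, `IsCarving.exists_dist_lt`).

Counting: averaging over t gives a sphere near which only O(m^(1-1/d)) separated points lie
(`exists_radius`). The carved ball contains at least m points of A, so each step lowers the number
of points by at least m/2, and all steps together create O(|C|/m^(1/d)) boundary points
(`CarvingState.exists_ball_step`, `exists_isCarving`). An additional point whose cell touches a
piece is a boundary point of the piece or was added later close to one; packing allows boundedly
many of the latter per boundary point (`IsCarving.isBoundary_or_later`, `IsCarving.card_later_le`).

A piece has at most r/2 original points. If its touching points make it larger than r, they
outnumber its original points, and each of these can be isolated by a tiny simplex of d+1 new points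
(`exists_isClosedDivision_of_classes`). Finally regions are merged in pairs until there are O(|C|/r)
of them. For bounded r it suffices to isolate every point. -/

/-- A division of `C` into regions of at most `r` points with boundary points `Z`, where the
regions are closed under contact of Voronoi cells; the number of regions is not restricted. -/
structure IsClosedDivision {E : Type*} [MetricSpace E] [DecidableEq E] (r : ℕ) (C Z : Finset E)
    (𝓡 : Finset (Finset E)) : Prop where
  subset : ∀ R ∈ 𝓡, R ⊆ C ∪ Z
  nonempty : ∀ R ∈ 𝓡, (R \ Z).Nonempty
  disjoint : ∀ R ∈ 𝓡, ∀ R' ∈ 𝓡, R ≠ R' → Disjoint (R \ Z) (R' \ Z)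
  union : 𝓡.biUnion (fun R => R \ Z) = C
  card_region : ∀ R ∈ 𝓡, R.card ≤ r
  contact : ∀ R ∈ 𝓡, ∀ p ∈ R \ Z, ∀ q ∈ C ∪ Z, ∀ x, dist x p = dist x q →
    (∀ s ∈ C ∪ Z, dist x p ≤ dist x s) → q ∈ R

/-! ### Merging regions -/

section Merge

variable {E : Type*} [MetricSpace E] [DecidableEq E]

/-- Closure under contact passes to unions, because each point of the union outside `Z` already lies
in one of the two regions. This is why `contact` is carried along instead of the separator property.
-/
theorem IsClosedDivision.merge {r : ℕ} {C Z : Finset E} {𝓡 : Finset (Finset E)}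
    (h : IsClosedDivision r C Z 𝓡) {R R' : Finset E} (hR : R ∈ 𝓡) (hR' : R' ∈ 𝓡)
    (hr : (R ∪ R').card ≤ r) :
    IsClosedDivision r C Z (insert (R ∪ R') ((𝓡.erase R).erase R')) := by
  have hmem : ∀ X ∈ (𝓡.erase R).erase R', X ∈ 𝓡 ∧ X ≠ R ∧ X ≠ R' := by
    intro X hX
    simp only [Finset.mem_erase] at hX
    exact ⟨hX.2.2, hX.2.1, hX.1⟩
  have hdis : ∀ X ∈ (𝓡.erase R).erase R', Disjoint ((R ∪ R') \ Z) (X \ Z) := by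
    intro X hX
    obtain ⟨h1, h2, h3⟩ := hmem X hX
    rw [Finset.union_sdiff_distrib, Finset.disjoint_union_left]
    exact ⟨h.disjoint _ hR _ h1 h2.symm, h.disjoint _ hR' _ h1 h3.symm⟩
  refine ⟨?_, ?_, ?_, ?_, ?_, ?_⟩
  · intro X hX
    rcases Finset.mem_insert.1 hX with rfl | hX
    · exact Finset.union_subset (h.subset _ hR) (h.subset _ hR')
    · exact h.subset _ (hmem X hX).1
  · intro X hX
    rcases Finset.mem_insert.1 hX with rfl | hX
    · rw [Finset.union_sdiff_distrib]
      exact (h.nonempty _ hR).mono Finset.subset_union_left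
    · exact h.nonempty _ (hmem X hX).1
  · intro X hX Y hY hXY
    rcases Finset.mem_insert.1 hX with rfl | hX <;> rcases Finset.mem_insert.1 hY with rfl | hY
    · exact absurd rfl hXY
    · exact hdis Y hY
    · exact (hdis X hX).symm
    · exact h.disjoint _ (hmem X hX).1 _ (hmem Y hY).1 hXY
  · rw [← h.union]
    ext c
    simp only [Finset.mem_biUnion, Finset.mem_insert, Finset.mem_erase, Finset.mem_sdiff]
    constructor
    · rintro ⟨X, rfl | hX, hc, hcZ⟩
      · rcases Finset.mem_union.1 hc with hc | hc
        exacts [⟨R, hR, hc, hcZ⟩, ⟨R', hR', hc, hcZ⟩]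
      · exact ⟨X, hX.2.2, hc, hcZ⟩
    · rintro ⟨X, hX, hc, hcZ⟩
      by_cases h1 : X = R
      · exact ⟨_, Or.inl rfl, Finset.mem_union_left _ (h1 ▸ hc), hcZ⟩
      by_cases h2 : X = R'
      · exact ⟨_, Or.inl rfl, Finset.mem_union_right _ (h2 ▸ hc), hcZ⟩
      exact ⟨X, Or.inr ⟨h2, h1, hX⟩, hc, hcZ⟩
  · intro X hX
    rcases Finset.mem_insert.1 hX with rfl | hX
    · exact hr
    · exact h.card_region _ (hmem X hX).1
  · intro X hX p hp q hq x hpq hx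
    rcases Finset.mem_insert.1 hX with rfl | hX
    · rw [Finset.union_sdiff_distrib] at hp
      rcases Finset.mem_union.1 hp with hp | hp
      · exact Finset.mem_union_left _ (h.contact _ hR p hp q hq x hpq hx)
      · exact Finset.mem_union_right _ (h.contact _ hR' p hp q hq x hpq hx)
    · exact h.contact _ (hmem X hX).1 p hp q hq x hpq hx

theorem IsClosedDivision.sum_card {r : ℕ} {C Z : Finset E} {𝓡 : Finset (Finset E)}
    (h : IsClosedDivision r C Z 𝓡) :
    ∑ R ∈ 𝓡, R.card = C.card + ∑ R ∈ 𝓡, (R ∩ Z).card := by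
  have : C.card = ∑ R ∈ 𝓡, (R \ Z).card := by
    conv_lhs => rw [← h.union]
    exact Finset.card_biUnion fun R hR R' hR' hne => h.disjoint R hR R' hR' hne
  rw [this, ← Finset.sum_add_distrib]
  exact Finset.sum_congr rfl fun R _ => (Finset.card_sdiff_add_card_inter R Z).symm

/-- If any two members of a family of finite sets have more than `r` elements together, then the
family has few members. -/
theorem card_mul_le_of_pairwise_lt_card_union {E : Type*} [DecidableEq E] {r : ℕ}
    {𝓡 : Finset (Finset E)}
    (h : ∀ R ∈ 𝓡, ∀ R' ∈ 𝓡, R ≠ R' → r < (R ∪ R').card) :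
    𝓡.card * r ≤ 2 * ∑ R ∈ 𝓡, R.card + r := by
  by_cases hs : ∃ R ∈ 𝓡, 2 * R.card ≤ r
  -- If `R₀` has at most r/2 points, every other member has at least r/2; the extra summand r pays
  -- for `R₀`.
  · obtain ⟨R₀, hR₀, h0⟩ := hs
    have h1 : (𝓡.erase R₀).card * r ≤ ∑ R ∈ 𝓡.erase R₀, 2 * R.card := by
      rw [← smul_eq_mul]
      refine Finset.card_nsmul_le_sum _ _ _ fun R hR => ?_
      have h2 := h R (Finset.mem_of_mem_erase hR) R₀ hR₀ (Finset.ne_of_mem_erase hR)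
      have h3 := Finset.card_union_le R R₀
      omega
    have h4 : ∑ R ∈ 𝓡.erase R₀, 2 * R.card ≤ ∑ R ∈ 𝓡, 2 * R.card :=
      Finset.sum_le_sum_of_subset (Finset.erase_subset _ _)
    rw [← Finset.card_erase_add_one hR₀, Finset.mul_sum, add_mul, one_mul]
    omega
  · push Not at hs
    have h1 : 𝓡.card * r ≤ ∑ R ∈ 𝓡, 2 * R.card := by
      rw [← smul_eq_mul]
      exact Finset.card_nsmul_le_sum _ _ _ fun R hR => (hs R hR).le
    rw [Finset.mul_sum]
    omega

/-- The regions of a division can be merged until there are few of them. -/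
theorem IsClosedDivision.exists_card_mul_le {r : ℕ} {C Z : Finset E} {𝓡 : Finset (Finset E)}
    (h : IsClosedDivision r C Z 𝓡) :
    ∃ 𝓡', IsClosedDivision r C Z 𝓡' ∧ ∑ R ∈ 𝓡', (R ∩ Z).card ≤ ∑ R ∈ 𝓡, (R ∩ Z).card ∧
      𝓡'.card * r ≤ 2 * ∑ R ∈ 𝓡', R.card + r := by
  induction hn : 𝓡.card using Nat.strong_induction_on generalizing 𝓡 with
  | _ n ih =>
    by_cases hp : ∃ R ∈ 𝓡, ∃ R' ∈ 𝓡, R ≠ R' ∧ (R ∪ R').card ≤ r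
    · obtain ⟨R, hR, R', hR', hne, hr⟩ := hp
      have hR'' : R' ∈ 𝓡.erase R := Finset.mem_erase.2 ⟨hne.symm, hR'⟩
      have e1 := Finset.card_erase_add_one hR
      have e2 := Finset.card_erase_add_one hR''
      have e3 := Finset.card_insert_le (R ∪ R') ((𝓡.erase R).erase R')
      obtain ⟨𝓡', h1, h2, h3⟩ := ih _ (by omega) (h.merge hR hR' hr) rfl
      refine ⟨𝓡', h1, h2.trans ?_, h3⟩
      rw [← Finset.add_sum_erase _ _ hR, ← Finset.add_sum_erase _ _ hR'', ← add_assoc]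
      have h4 : ((R ∪ R') ∩ Z).card ≤ (R ∩ Z).card + (R' ∩ Z).card := by
        rw [Finset.union_inter_distrib_right]
        exact Finset.card_union_le _ _
      by_cases hm : R ∪ R' ∈ (𝓡.erase R).erase R'
      · rw [Finset.insert_eq_of_mem hm]
        omega
      · rw [Finset.sum_insert hm]
        omega
    · push Not at hp
      exact ⟨𝓡, h, le_rfl, card_mul_le_of_pairwise_lt_card_union hp⟩

end Merge

/-! ### Voronoi separators from closure under contact -/

theorem frontier_voronoiCell_subset {d : ℕ} (S : Set (EuclideanSpace ℝ (Fin d)))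
    (p : EuclideanSpace ℝ (Fin d)) : frontier (voronoiCell S p) ⊆ voronoiCell S p := by
  refine IsClosed.frontier_subset ?_
  have : voronoiCell S p = ⋂ q ∈ S, {x | dist x p ≤ dist x q} := by
    ext x
    simp [voronoiCell]
  rw [this]
  exact isClosed_biInter fun q _ => isClosed_le (by fun_prop) (by fun_prop)

open Classical in
-- Cells are closed, so a common frontier point lies in both cells: it is equidistant from the two
-- sites and no site is nearer. Then `contact` puts the second site into `R`.
theorem IsClosedDivision.separator {d r : ℕ} {C Z : Finset (EuclideanSpace ℝ (Fin d))}
    {𝓡 : Finset (Finset (EuclideanSpace ℝ (Fin d)))} (h : IsClosedDivision r C Z 𝓡)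
    {R : Finset (EuclideanSpace ℝ (Fin d))} (hR : R ∈ 𝓡) :
    IsVoronoiSeparator ((R ∩ Z : Finset _) : Set (EuclideanSpace ℝ (Fin d)))
      ((R \ Z : Finset _) : Set (EuclideanSpace ℝ (Fin d)))
      (((C ∪ Z) \ R : Finset _) : Set (EuclideanSpace ℝ (Fin d))) := by
  intro p hp q hq
  have hS : ((R \ Z : Finset _) : Set (EuclideanSpace ℝ (Fin d))) ∪ ((C ∪ Z) \ R : Finset _) ∪
      (R ∩ Z : Finset _) = (C ∪ Z : Finset _) := by
    have h1 := h.subset R hR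
    ext x
    have h2 := @h1 x
    simp only [Set.mem_union, Finset.mem_coe, Finset.mem_sdiff, Finset.mem_inter,
      Finset.mem_union] at h2 ⊢
    tauto
  rw [hS, Set.disjoint_left]
  intro x hx hx'
  have h1 := frontier_voronoiCell_subset _ _ hx
  have h2 := frontier_voronoiCell_subset _ _ hx'
  rw [Finset.mem_coe] at hp hq
  obtain ⟨hq1, hq2⟩ := Finset.mem_sdiff.1 hq
  have hpS : p ∈ C ∪ Z := h.subset R hR (Finset.mem_sdiff.1 hp).1
  exact hq2 (h.contact R hR p hp q hq1 x (le_antisymm (h1 q hq1) (h2 p hpS)) h1)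

/-! ### Isolating a point by a simplex -/

section Simplex

theorem norm_le_norm_sub_iff {E : Type*} [NormedAddCommGroup E] [InnerProductSpace ℝ E] (u v : E) :
    ‖u‖ ≤ ‖u - v‖ ↔ 2 * inner ℝ u v ≤ ‖v‖ ^ 2 := by
  rw [← sq_le_sq₀ (norm_nonneg _) (norm_nonneg _), norm_sub_sq_real]
  constructor <;> intro h <;> linarith

/-- A finite set of `d + 1` directions such that the points nearer to `0` than to the scaled
directions are within a bounded distance. -/
theorem exists_simplex_directions (d : ℕ) :
    ∃ V : Finset (EuclideanSpace ℝ (Fin d)), ∃ κ : ℝ, 0 < κ ∧ V.card ≤ d + 1 ∧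
      (∀ v ∈ V, ‖v‖ ≤ κ ∧ (0 < d → v ≠ 0)) ∧
      ∀ σ : ℝ, 0 < σ → ∀ u : EuclideanSpace ℝ (Fin d), (∀ v ∈ V, ‖u‖ ≤ ‖u - σ • v‖) →
        ‖u‖ ≤ κ * σ := by
  classical
  set e : Fin d → EuclideanSpace ℝ (Fin d) := fun i => EuclideanSpace.single i 1 with he
  set g : EuclideanSpace ℝ (Fin d) := -∑ i, e i with hg
  have hcoord : ∀ i, g i = -1 := by
    intro i
    simp [hg, he]
  have hgn : ‖g‖ ^ 2 = d := by
    rw [EuclideanSpace.norm_sq_eq]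
    simp [hcoord]
  have hig : ∀ u : EuclideanSpace ℝ (Fin d), inner ℝ u g = -∑ i, u i := by
    intro u
    simp [PiLp.inner_apply, hcoord]
  -- The vertices e i bound the coordinates of u from above and g = -∑ e i bounds their sum from
  -- below, so every coordinate is bounded on both sides. For d = 0 the vector g vanishes.
  refine ⟨insert g (Finset.univ.image e), (d + 1) * (d + 1), by positivity, ?_, ?_, ?_⟩
  · refine (Finset.card_insert_le _ _).trans ?_
    have := (Finset.card_image_le (s := (Finset.univ : Finset (Fin d))) (f := e))
    simp only [Finset.card_univ, Fintype.card_fin] at this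
    omega
  · intro v hv
    rcases Finset.mem_insert.1 hv with rfl | hv
    · constructor
      · refine abs_le_of_sq_le_sq' ?_ (by positivity) |>.2
        rw [hgn]
        have : (0 : ℝ) ≤ d := by positivity
        nlinarith [pow_nonneg this 2, pow_nonneg this 3, pow_nonneg this 4]
      · intro hd h0
        rw [h0] at hgn
        have h1 : (d : ℝ) = 0 := by simpa using hgn.symm
        exact hd.ne' (by exact_mod_cast h1)
    · obtain ⟨i, -, rfl⟩ := Finset.mem_image.1 hv
      have hn : ‖e i‖ = 1 := by simp [he]
      refine ⟨?_, fun _ h0 => ?_⟩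
      · rw [hn]
        have : (0 : ℝ) ≤ d := by positivity
        nlinarith
      · rw [h0] at hn
        simp at hn
  · intro σ hσ u hu
    have h1 : ∀ i, u i ≤ σ / 2 := by
      intro i
      have := (norm_le_norm_sub_iff _ _).1 (hu (e i) (by simp))
      rw [inner_smul_right, norm_smul] at this
      have hn : ‖e i‖ = 1 := by simp [he]
      have hin : inner ℝ u (e i) = u i := by
        simp [he, EuclideanSpace.inner_single_right]
      rw [hin, hn, mul_one, Real.norm_eq_abs, sq_abs] at this
      nlinarith
    have h2 : -∑ i, u i ≤ σ * d / 2 := by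
      have := (norm_le_norm_sub_iff _ _).1 (hu g (by simp))
      rw [inner_smul_right, norm_smul, mul_pow, hgn, hig, Real.norm_eq_abs, sq_abs] at this
      nlinarith
    have h3 : ∀ i, |u i| ≤ σ * (d + 1) := by
      intro i
      have h4 : ∑ j ∈ Finset.univ.erase i, u j ≤ d * (σ / 2) := by
        refine (Finset.sum_le_card_nsmul _ _ (σ / 2) fun j _ => h1 j).trans ?_
        rw [nsmul_eq_mul]
        gcongr
        exact (Finset.card_le_univ _).trans (by simp)
      have h5 := Finset.add_sum_erase Finset.univ (fun j => u j) (Finset.mem_univ i)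
      simp only at h5
      rw [abs_le]
      have hd : (0 : ℝ) ≤ d := by positivity
      constructor
      · nlinarith
      · nlinarith [h1 i]
    have h6 : ‖u‖ ^ 2 ≤ ((d + 1) * (d + 1) * σ) ^ 2 := by
      rw [EuclideanSpace.norm_sq_eq]
      have h7 : ∑ i, ‖u i‖ ^ 2 ≤ ∑ i : Fin d, (σ * (d + 1)) ^ 2 := by
        refine Finset.sum_le_sum fun i _ => ?_
        rw [Real.norm_eq_abs]
        gcongr
        exact h3 i
      refine h7.trans ?_
      rw [Finset.sum_const, Finset.card_univ, Fintype.card_fin, nsmul_eq_mul]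
      have hd : (0 : ℝ) ≤ d := by positivity
      have : (d : ℝ) ≤ (d + 1) ^ 2 := by nlinarith
      calc (d : ℝ) * (σ * (d + 1)) ^ 2 ≤ (d + 1) ^ 2 * (σ * (d + 1)) ^ 2 := by gcongr
        _ = _ := by ring
    exact (abs_le_of_sq_le_sq' h6 (by positivity)).2

end Simplex

/-! ### Divisions from separated classes -/

theorem Finset.exists_pos_forall_le {ι : Type*} (I : Finset ι) (f : ι → ℝ)
    (h : ∀ i ∈ I, 0 < f i) : ∃ δ > 0, ∀ i ∈ I, δ ≤ f i := by
  rcases I.eq_empty_or_nonempty with rfl | hI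
  · exact ⟨1, one_pos, by simp⟩
  · obtain ⟨i, hi, hmin⟩ := I.exists_min_image f hI
    exact ⟨f i, h i hi, hmin⟩

open Classical in
/-- The points of `Z` whose cell can touch the cell of a point of class `j`. -/
noncomputable def touchingPoints {E : Type*} [MetricSpace E] (f : E → ℕ) (C Z : Finset E) (j : ℕ) :
    Finset E :=
  Z.filter fun z => ∃ p ∈ C, f p = j ∧ ∃ x, dist x p = dist x z ∧ ∀ w ∈ Z, dist x p ≤ dist x w

open Classical in
/-- If the classes of `C` are robustly separated by `Z`, there is a division of `C` in which the
good classes are regions, and all other points are isolated by small simplices. -/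
theorem exists_isClosedDivision_of_classes {d r : ℕ} (hd : 1 ≤ d) (hr : d + 2 ≤ r)
    {C Z : Finset (EuclideanSpace ℝ (Fin d))} (hCZ : Disjoint C Z)
    (f : EuclideanSpace ℝ (Fin d) → ℕ) {τ : ℝ} (hτ : 0 < τ)
    (hsep : ∀ p ∈ C, ∀ c ∈ C, f p ≠ f c → ∀ z, dist z c ≤ τ → ∀ x, dist x p = dist x z →
      ∃ w ∈ Z, dist x w < dist x p)
    (good : ℕ → Prop)
    (hgood : ∀ j, good j → (C.filter (f · = j)).card + (touchingPoints f C Z j).card ≤ r) :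
    ∃ Z' 𝓡, IsClosedDivision r C Z' 𝓡 ∧ ∑ R ∈ 𝓡, (R ∩ Z').card ≤
      ∑ j ∈ (C.image f).filter good, (touchingPoints f C Z j).card +
        (C.filter fun c => ¬ good (f c)).card * (d + 1) := by
  obtain ⟨V, κ, hκ, hVc, hV, hVs⟩ := exists_simplex_directions d
  have hV0 : ∀ v ∈ V, v ≠ 0 := fun v hv => (hV v hv).2 hd
  obtain ⟨δ, hδ, hδS⟩ := ((C ∪ Z).offDiag).exists_pos_forall_le (fun q => dist q.1 q.2) (by
    intro q hq
    exact dist_pos.2 (Finset.mem_offDiag.1 hq).2.2)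
  have hδ' : ∀ s ∈ C ∪ Z, ∀ s' ∈ C ∪ Z, dist s s' < δ → s = s' := by
    intro s hs s' hs' hlt
    by_contra hne
    exact absurd (hδS (s, s') (Finset.mem_offDiag.2 ⟨hs, hs', hne⟩)) (not_le.2 hlt)
  -- The simplices have radius κσ. At most τ, so that `hsep` also covers their vertices; at most
  -- δ/4, so that the cell of an isolated point touches only cells of its own vertices (2κσ and 3κσ
  -- are below δ).
  set σ : ℝ := min τ (δ / 4) / κ with hσ
  have hσ0 : 0 < σ := by positivity
  have hκσ : κ * σ = min τ (δ / 4) := by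
    rw [hσ]
    field_simp
  have hκτ : κ * σ ≤ τ := hκσ.le.trans (min_le_left _ _)
  have hκδ : κ * σ ≤ δ / 4 := hκσ.le.trans (min_le_right _ _)
  set bad : Finset (EuclideanSpace ℝ (Fin d)) := C.filter fun c => ¬ good (f c) with hbad
  set X : EuclideanSpace ℝ (Fin d) → Finset (EuclideanSpace ℝ (Fin d)) :=
    fun c => V.image fun v => c + σ • v with hX
  have hXdist : ∀ c, ∀ q ∈ X c, dist q c ≤ κ * σ ∧ q ≠ c := by
    intro c q hq
    obtain ⟨v, hv, rfl⟩ := Finset.mem_image.1 hq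
    constructor
    · rw [dist_self_add_left, norm_smul, Real.norm_of_nonneg hσ0.le, mul_comm]
      gcongr
      exact (hV v hv).1
    · simp [hσ0.ne', hV0 v hv]
  set Z' := Z ∪ bad.biUnion X with hZ'
  have hmemZ' : ∀ q, q ∈ Z' ↔ q ∈ Z ∨ ∃ c ∈ bad, q ∈ X c := by
    intro q
    simp [hZ']
  have hbadC : ∀ c ∈ bad, c ∈ C := fun c hc => (Finset.mem_filter.1 hc).1
  have hCZ' : ∀ c ∈ C, c ∉ Z' := by
    intro c hc hcZ
    rcases (hmemZ' c).1 hcZ with h | ⟨c', hc', h⟩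
    · exact Finset.disjoint_left.1 hCZ hc h
    · obtain ⟨h1, h2⟩ := hXdist c' c h
      exact h2 (hδ' c (Finset.mem_union_left _ hc) c' (Finset.mem_union_left _ (hbadC c' hc'))
        (by linarith))
  set F : ℕ ⊕ EuclideanSpace ℝ (Fin d) → Finset (EuclideanSpace ℝ (Fin d)) :=
    Sum.elim (fun j => C.filter (f · = j) ∪ touchingPoints f C Z j) (fun c => insert c (X c)) with hF
  set I := ((C.image f).filter good).disjSum bad with hI
  have htZ : ∀ j, touchingPoints f C Z j ⊆ Z' := fun j =>
    (Finset.filter_subset _ _).trans Finset.subset_union_left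
  have hXZ : ∀ c ∈ bad, X c ⊆ Z' := fun c hc q hq => (hmemZ' q).2 (Or.inr ⟨c, hc, hq⟩)
  have hFl : ∀ j, F (Sum.inl j) \ Z' = C.filter (f · = j) := by
    intro j
    ext q
    have h1 := @htZ j q
    have h2 := hCZ' q
    simp only [hF, Sum.elim_inl, Finset.mem_sdiff, Finset.mem_union, Finset.mem_filter]
    tauto
  have hFr : ∀ c ∈ bad, F (Sum.inr c) \ Z' = {c} := by
    intro c hc
    ext q
    have h1 := @hXZ c hc q
    have h2 := hCZ' c (hbadC c hc)
    simp only [hF, Sum.elim_inr, Finset.mem_sdiff, Finset.mem_insert, Finset.mem_singleton]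
    constructor
    · tauto
    · rintro rfl
      exact ⟨Or.inl rfl, h2⟩
  have hFlc : ∀ j, F (Sum.inl j) ∩ Z' ⊆ touchingPoints f C Z j := by
    intro j q
    have h2 := hCZ' q
    simp only [hF, Sum.elim_inl, Finset.mem_inter, Finset.mem_union, Finset.mem_filter]
    tauto
  have hFrc : ∀ c ∈ bad, F (Sum.inr c) ∩ Z' ⊆ X c := by
    intro c hc q
    have h2 := hCZ' c (hbadC c hc)
    simp only [hF, Sum.elim_inr, Finset.mem_inter, Finset.mem_insert]
    rintro ⟨rfl | h, h'⟩
    exacts [absurd h' h2, h]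
  have hXc : ∀ c, (X c).card ≤ d + 1 := fun c => Finset.card_image_le.trans hVc
  have hcls : ∀ c ∈ C, ∀ i ∈ I, c ∈ F i \ Z' →
      (good (f c) ∧ i = Sum.inl (f c)) ∨ (¬ good (f c) ∧ i = Sum.inr c) := by
    intro c hc i hi hci
    rcases i with j | b
    · rw [hFl] at hci
      have h1 := (Finset.mem_filter.1 hci).2
      have h2 := (Finset.mem_filter.1 (Finset.inl_mem_disjSum.1 hi)).2
      subst h1
      exact Or.inl ⟨h2, rfl⟩
    · have hb := Finset.inr_mem_disjSum.1 hi
      rw [hFr b hb] at hci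
      rw [Finset.mem_singleton.1 hci]
      exact Or.inr ⟨(Finset.mem_filter.1 hb).2, rfl⟩
  have hFC : ∀ i ∈ I, F i \ Z' ⊆ C := by
    intro i hi
    rcases i with j | b
    · rw [hFl]
      exact Finset.filter_subset _ _
    · have hb := Finset.inr_mem_disjSum.1 hi
      rw [hFr b hb]
      exact Finset.singleton_subset_iff.2 (hbadC b hb)
  refine ⟨Z', I.image F, ⟨?_, ?_, ?_, ?_, ?_, ?_⟩, ?_⟩
  · intro R hR
    obtain ⟨i, hi, rfl⟩ := Finset.mem_image.1 hR
    intro q hq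
    by_cases hqZ : q ∈ Z'
    · exact Finset.mem_union_right _ hqZ
    · exact Finset.mem_union_left _ (hFC i hi (Finset.mem_sdiff.2 ⟨hq, hqZ⟩))
  · intro R hR
    obtain ⟨i, hi, rfl⟩ := Finset.mem_image.1 hR
    rcases i with j | b
    · rw [hFl]
      obtain ⟨h1, -⟩ := Finset.mem_filter.1 (Finset.inl_mem_disjSum.1 hi)
      obtain ⟨c, hc, hcj⟩ := Finset.mem_image.1 h1
      exact ⟨c, Finset.mem_filter.2 ⟨hc, hcj⟩⟩
    · rw [hFr b (Finset.inr_mem_disjSum.1 hi)]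
      exact Finset.singleton_nonempty b
  · intro R hR R' hR' hne
    obtain ⟨i, hi, rfl⟩ := Finset.mem_image.1 hR
    obtain ⟨i', hi', rfl⟩ := Finset.mem_image.1 hR'
    rw [Finset.disjoint_left]
    intro c hc hc'
    have hcC := hFC i hi hc
    apply hne
    rcases hcls c hcC i hi hc with ⟨h1, h2⟩ | ⟨h1, h2⟩ <;>
      rcases hcls c hcC i' hi' hc' with ⟨h3, h4⟩ | ⟨h3, h4⟩
    · rw [h2, h4]
    · exact absurd h1 h3
    · exact absurd h3 h1
    · rw [h2, h4]
  · apply Finset.Subset.antisymm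
    · intro c hc
      obtain ⟨R, hR, hcR⟩ := Finset.mem_biUnion.1 hc
      obtain ⟨i, hi, rfl⟩ := Finset.mem_image.1 hR
      exact hFC i hi hcR
    · intro c hc
      refine Finset.mem_biUnion.2 ?_
      by_cases hg : good (f c)
      · refine ⟨F (Sum.inl (f c)), Finset.mem_image_of_mem _ (Finset.inl_mem_disjSum.2
          (Finset.mem_filter.2 ⟨Finset.mem_image_of_mem _ hc, hg⟩)), ?_⟩
        rw [hFl]
        exact Finset.mem_filter.2 ⟨hc, rfl⟩
      · have hb : c ∈ bad := Finset.mem_filter.2 ⟨hc, hg⟩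
        refine ⟨F (Sum.inr c), Finset.mem_image_of_mem _ (Finset.inr_mem_disjSum.2 hb), ?_⟩
        rw [hFr c hb]
        exact Finset.mem_singleton_self c
  · intro R hR
    obtain ⟨i, hi, rfl⟩ := Finset.mem_image.1 hR
    rcases i with j | b
    · exact (Finset.card_union_le _ _).trans
        (hgood j (Finset.mem_filter.1 (Finset.inl_mem_disjSum.1 hi)).2)
    · have h1 := Finset.card_insert_le b (X b)
      have h2 := hXc b
      simp only [hF, Sum.elim_inr]
      omega
  · intro R hR p hp q hq x hpq hx
    obtain ⟨i, hi, rfl⟩ := Finset.mem_image.1 hR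
    have hpC := hFC i hi hp
    have hxZ : ∀ w ∈ Z, dist x p ≤ dist x w := fun w hw =>
      hx w (Finset.mem_union_right _ (Finset.mem_union_left _ hw))
    rcases hcls p hpC i hi hp with ⟨hg, rfl⟩ | ⟨hg, rfl⟩
    -- Used for q = c and for q a simplex vertex at c. In the latter case c would be a bad point of
    -- a good class, which is impossible since goodness depends on the class only.
    · have hfar : ∀ c ∈ C, dist q c ≤ τ → f p = f c := by
        intro c hc hqc
        by_contra hne
        obtain ⟨w, hw, hlt⟩ := hsep p hpC c hc hne q hqc x hpq
        exact absurd (hxZ w hw) (not_le.2 hlt)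
      rcases Finset.mem_union.1 hq with hqC | hqZ
      · refine Finset.mem_union_left _ (Finset.mem_filter.2 ⟨hqC, (hfar q hqC ?_).symm⟩)
        rw [dist_self]
        exact hτ.le
      · rcases (hmemZ' q).1 hqZ with hqZ | ⟨c, hc, hqc⟩
        · exact Finset.mem_union_right _ (Finset.mem_filter.2 ⟨hqZ, p, hpC, rfl, x, hpq, hxZ⟩)
        · have h1 := hfar c (hbadC c hc) ((hXdist c q hqc).1.trans hκτ)
          exact absurd (h1 ▸ hg) (Finset.mem_filter.1 hc).2
    · have hb : p ∈ bad := Finset.mem_filter.2 ⟨hpC, hg⟩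
      have h1 : ‖x - p‖ ≤ κ * σ := by
        refine hVs σ hσ0 (x - p) fun v hv => ?_
        have := hx (p + σ • v) (Finset.mem_union_right _ (hXZ p hb (Finset.mem_image_of_mem _ hv)))
        rwa [dist_eq_norm, dist_eq_norm, ← sub_sub] at this
      rw [← dist_eq_norm] at h1
      have h2 : dist q p ≤ 2 * (κ * σ) := by
        have := dist_triangle_left q p x
        linarith
      have hpS : p ∈ C ∪ Z := Finset.mem_union_left _ hpC
      have hold : q ∈ C ∪ Z → q = p := fun h => hδ' q h p hpS (by linarith)
      refine Finset.mem_insert.2 ?_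
      rcases Finset.mem_union.1 hq with hqC | hqZ
      · exact Or.inl (hold (Finset.mem_union_left _ hqC))
      · rcases (hmemZ' q).1 hqZ with hqZ | ⟨c, hc, hqc⟩
        · exact Or.inl (hold (Finset.mem_union_right _ hqZ))
        · have h3 := (hXdist c q hqc).1
          have h4 := dist_triangle_left c p q
          have h5 : c = p := hδ' c (Finset.mem_union_left _ (hbadC c hc)) p hpS (by
            linarith)
          exact Or.inr (h5 ▸ hqc)
  · calc ∑ R ∈ I.image F, (R ∩ Z').card ≤ ∑ i ∈ I, (F i ∩ Z').card :=
        Finset.sum_image_le_of_nonneg fun _ _ => Nat.zero_le _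
      _ = ∑ j ∈ (C.image f).filter good, (F (Sum.inl j) ∩ Z').card +
          ∑ c ∈ bad, (F (Sum.inr c) ∩ Z').card := by rw [hI, Finset.sum_disjSum]
      _ ≤ _ := by
        refine add_le_add (Finset.sum_le_sum fun j _ => Finset.card_le_card (hFlc j)) ?_
        rw [← smul_eq_mul]
        exact Finset.sum_le_card_nsmul _ _ _ fun c hc =>
          (Finset.card_le_card (hFrc c hc)).trans (hXc c)

/-! ### Segments crossing frontiers -/

section Segments

variable {E : Type*} [NormedAddCommGroup E] [NormedSpace ℝ E]

/-- On the way from `x` to a point of a finite union of closed sets, there is a first point of the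
union. -/
theorem exists_first_hit {ι : Type*} (I : Finset ι) (F : ι → Set E) (hF : ∀ i ∈ I, IsClosed (F i))
    {x z : E} (hx : ∀ i ∈ I, x ∉ F i) (hz : ∃ i ∈ I, z ∈ F i) :
    ∃ y ∈ segment ℝ x z, (∃ i ∈ I, y ∈ F i) ∧ ∀ i ∈ I, y ∉ interior (F i) := by
  set g : ℝ → E := fun t => AffineMap.lineMap x z t with hg
  have hgc : Continuous g := by
    rw [hg]
    exact AffineMap.lineMap_continuous
  set T : Set ℝ := Set.Icc 0 1 ∩ g ⁻¹' (⋃ i ∈ I, F i) with hT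
  have hTc : IsCompact T := isCompact_Icc.inter_right
    ((I.finite_toSet.isClosed_biUnion hF).preimage hgc)
  obtain ⟨i₀, hi₀, hzi⟩ := hz
  have hT1 : (1 : ℝ) ∈ T := ⟨by simp, by simpa [hg] using ⟨i₀, hi₀, hzi⟩⟩
  obtain ⟨t, ⟨⟨ht0, ht1⟩, htF⟩, hmin⟩ := hTc.exists_isLeast ⟨1, hT1⟩
  obtain ⟨i, hi, hti⟩ := Set.mem_iUnion₂.1 htF
  refine ⟨g t, ?_, ⟨i, hi, hti⟩, ?_⟩
  · rw [segment_eq_image_lineMap]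
    exact ⟨t, ⟨ht0, ht1⟩, rfl⟩
  · intro k hk hint
    have ht : 0 < t := by
      refine lt_of_le_of_ne ht0 ?_
      rintro rfl
      exact hx i hi (by simpa [hg] using hti)
    have hopen : g ⁻¹' interior (F k) ∈ nhds t := (isOpen_interior.preimage hgc).mem_nhds hint
    obtain ⟨s, hs, hst⟩ := mem_nhdsLT_iff_exists_Ioo_subset' ht |>.1 (mem_nhdsWithin_of_mem_nhds hopen)
    obtain ⟨u, hu1, hu2⟩ := exists_between (max_lt hs.out ht)
    have h1 : u ∈ T := ⟨⟨((le_max_right _ _).trans_lt hu1).le, (hu2.trans_le ht1).le⟩,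
      Set.mem_iUnion₂.2 ⟨k, hk, interior_subset (hst ⟨(le_max_left _ _).trans_lt hu1, hu2⟩)⟩⟩
    exact absurd (hmin h1) (not_le.2 hu2)

/-- A segment from the closure of an open set to its complement meets the frontier. -/
theorem exists_mem_segment_frontier {B : Set E} (hB : IsOpen B) {x z : E} (hx : x ∈ closure B)
    (hz : z ∉ B) : ∃ y ∈ segment ℝ x z, y ∈ frontier B := by
  by_cases hxB : x ∈ B
  · obtain ⟨y, hy, ⟨_, _, hyB⟩, hint⟩ := exists_first_hit {()} (fun _ : Unit => Bᶜ)
      (fun _ _ => hB.isClosed_compl) (x := x) (z := z) (by simpa using hxB) (by simpa using hz)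
    refine ⟨y, hy, ?_⟩
    have hcl := hint () (by simp)
    rw [interior_compl] at hcl
    rw [hB.frontier_eq]
    exact ⟨not_not.1 hcl, hyB⟩
  · exact ⟨x, left_mem_segment ℝ x z, by rw [hB.frontier_eq]; exact ⟨hx, hxB⟩⟩

theorem dist_le_of_mem_segment {x y z : E} (hy : y ∈ segment ℝ x z) :
    dist x y ≤ dist x z ∧ dist y z ≤ dist x z := by
  have h := dist_add_dist_of_mem_segment hy
  constructor <;> linarith [dist_nonneg (x := x) (y := y), dist_nonneg (x := y) (y := z)]

/-- If `z` is at least as near to `x` as `w`, this is so for all points between `x` and `z`. -/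
theorem dist_le_dist_of_mem_segment {x y z w : E} (hy : y ∈ segment ℝ x z)
    (h : dist x z ≤ dist x w) : dist y z ≤ dist y w := by
  have h1 := dist_add_dist_of_mem_segment hy
  have h2 := dist_triangle x y w
  linarith

end Segments

/-! ### Carvings and the separation of their pieces -/

/-- A sequence of open sets `B j` that are successively carved out of the space. `C j` and `Y j` are
the original and the additional points which are left before step `j`, `N j` are the points added
on the frontier of `B j` in step `j`, and `H j` is a local scale. -/
structure IsCarving {E : Type*} [NormedAddCommGroup E] (B : ℕ → Set E)
    (C Y N : ℕ → Finset E) (H : ℕ → E → ℝ) : Prop where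
  isOpen : ∀ j, IsOpen (B j)
  C_frontier : ∀ j, ∀ c ∈ C j, c ∉ frontier (B j)
  C_succ : ∀ j c, c ∈ C (j + 1) ↔ c ∈ C j ∧ c ∉ B j
  Y_zero : Y 0 = ∅
  Y_succ : ∀ j a, a ∈ Y (j + 1) ↔
    (a ∈ Y j ∧ (a ∉ B j ∨ ∃ y ∈ frontier (B j), dist a y ≤ H j a / 10)) ∨ a ∈ N j
  N_frontier : ∀ j, ∀ z ∈ N j, z ∈ frontier (B j)
  N_out : ∀ j, ∀ z ∈ N j, ∀ l < j, z ∉ B l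
  N_pos : ∀ j, ∀ z ∈ N j, 0 < H j z
  N_sep : ∀ j, ∀ z ∈ N j, ∀ a, a ∈ N j ∨ a ∈ Y j → a ≠ z →
    H j z / 100 ≤ dist z a ∧ H j a / 100 ≤ dist z a
  cover : ∀ j, ∀ y ∈ frontier (B j), (∀ l < j, y ∉ B l) →
    ∃ w, (w ∈ N j ∨ w ∈ Y j) ∧ dist y w ≤ H j y / 50
  lip : ∀ j x y, H j x ≤ H j y + dist x y
  mono : ∀ j x, H j x ≤ H (j + 1) x
  zero : ∀ j, ∀ c ∈ C j, H j c ≤ 0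
  H_eq : ∀ j, ∀ a ∈ Y (j + 1), H (j + 1) a = H j a

namespace IsCarving

variable {E : Type*} [NormedAddCommGroup E] {B : ℕ → Set E}
  {C Y N : ℕ → Finset E} {H : ℕ → E → ℝ}

/-- The point `a` is near the frontier of the `j`-th set, with respect to the local scale. -/
def Near (B : ℕ → Set E) (H : ℕ → E → ℝ) (j : ℕ) (a : E) : Prop :=
  ∃ y ∈ frontier (B j), dist a y ≤ H j a / 10

theorem H_mono (h : IsCarving B C Y N H) (x : E) : Monotone fun j => H j x :=
  monotone_nat_of_le_succ fun j => h.mono j x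

theorem C_anti (h : IsCarving B C Y N H) {k l : ℕ} (hkl : k ≤ l) : C l ⊆ C k := by
  induction l, hkl using Nat.le_induction with
  | base => exact subset_rfl
  | succ l _ ih => exact fun c hc => ih ((h.C_succ l c).1 hc).1

theorem notMem_of_lt (h : IsCarving B C Y N H) {k l : ℕ} (hkl : k < l) {c : E} (hc : c ∈ C l) :
    c ∉ B k :=
  ((h.C_succ k c).1 (h.C_anti hkl hc)).2

theorem notMem_closure_of_lt (h : IsCarving B C Y N H) {k l : ℕ} (hkl : k < l) {c : E}
    (hc : c ∈ C l) : c ∉ closure (B k) := by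
  intro hcl
  refine h.C_frontier k c (h.C_anti hkl.le hc) ?_
  rw [(h.isOpen k).frontier_eq]
  exact ⟨hcl, h.notMem_of_lt hkl hc⟩

/-- The scale vanishes at c and is 1-Lipschitz. So a frontier point that is covered within H/50 is
at least 50 times nearer to an additional point than to any original point left. -/
theorem H_le_dist (h : IsCarving B C Y N H) {k : ℕ} {c : E} (hc : c ∈ C k) (y : E) :
    H k y ≤ dist y c := by
  linarith [h.lip k y c, h.zero k c hc]

theorem exists_mem_N (h : IsCarving B C Y N H) {j : ℕ} {a : E} (ha : a ∈ Y j) : ∃ i, a ∈ N i := by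
  induction j with
  | zero => simp [h.Y_zero] at ha
  | succ j ih =>
    rcases (h.Y_succ j a).1 ha with h1 | h1
    · exact ih h1.1
    · exact ⟨j, h1⟩

theorem Y_pos (h : IsCarving B C Y N H) {j : ℕ} {a : E} (ha : a ∈ Y j) : 0 < H j a := by
  induction j with
  | zero => simp [h.Y_zero] at ha
  | succ j ih =>
    rw [h.H_eq j a ha]
    rcases (h.Y_succ j a).1 ha with h1 | h1
    · exact ih h1.1
    · exact h.N_pos j a h1

theorem mem_Y_succ_of_near (h : IsCarving B C Y N H) {j : ℕ} {a : E} (ha : a ∈ Y j)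
    (hn : a ∈ B j → Near B H j a) : a ∈ Y (j + 1) := by
  refine (h.Y_succ j a).2 (Or.inl ⟨ha, ?_⟩)
  by_cases haB : a ∈ B j
  · exact Or.inr (hn haB)
  · exact Or.inl haB

/-- The uncovered part of a frontier is near its covering points. -/
theorem dist_le_of_frontier (h : IsCarving B C Y N H) {Z : Finset E} (hZ : ∀ j, N j ⊆ Z) {k : ℕ}
    {y z : E} (hy : y ∈ frontier (B k)) (hout : ∀ l < k, y ∉ B l)
    (hmin : ∀ w ∈ Z, dist y z ≤ dist y w) :
    dist y z ≤ H k y / 50 ∧ ∃ w, (w ∈ N k ∨ w ∈ Y k) ∧ dist y w ≤ H k y / 50 := by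
  obtain ⟨w, hw, hd⟩ := h.cover k y hy hout
  refine ⟨(hmin w ?_).trans hd, w, hw, hd⟩
  rcases hw with hw | hw
  · exact hZ k hw
  · obtain ⟨i, hi⟩ := h.exists_mem_N hw
    exact hZ i hi

variable [NormedSpace ℝ E]

theorem near_of_segment (h : IsCarving B C Y N H) {j : ℕ} {y a : E} (hy : y ∈ closure (B j))
    (ha : a ∉ B j) (hd : dist y a ≤ H j a / 10) : Near B H j a := by
  obtain ⟨y', hy', hf⟩ := exists_mem_segment_frontier (h.isOpen j) hy ha
  exact ⟨y', hf, by rw [dist_comm]; exact (dist_le_of_mem_segment hy').2.trans hd⟩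

theorem near_of_segment' (h : IsCarving B C Y N H) {j : ℕ} {y a : E} (hy : y ∉ B j)
    (ha : a ∈ B j) (hd : dist y a ≤ H j a / 10) : Near B H j a := by
  obtain ⟨y', hy', hf⟩ := exists_mem_segment_frontier (h.isOpen j) (subset_closure ha) hy
  exact ⟨y', hf, (dist_le_of_mem_segment hy').1.trans (by rwa [dist_comm])⟩

/-- A segment that leaves the complement of the closures of the first sets passes through an
uncovered part of one of the frontiers. -/
theorem exists_hit (h : IsCarving B C Y N H) {n : ℕ} {x z : E} (hx : ∀ l < n, x ∉ closure (B l))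
    (hz : ∃ l < n, z ∈ closure (B l)) :
    ∃ y ∈ segment ℝ x z, ∃ k < n, y ∈ frontier (B k) ∧ ∀ l < n, y ∉ B l := by
  obtain ⟨y, hy, ⟨k, hk, hyk⟩, hint⟩ := exists_first_hit (Finset.range n) (fun l => closure (B l))
    (fun _ _ => isClosed_closure) (fun l hl => hx l (Finset.mem_range.1 hl))
    (by simpa using hz)
  have hout : ∀ l < n, y ∉ B l := fun l hl hyl => hint l (Finset.mem_range.2 hl)
    (interior_mono subset_closure ((h.isOpen l).interior_eq.symm ▸ hyl))
  have hk' := Finset.mem_range.1 hk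
  refine ⟨y, hy, k, hk', ?_, hout⟩
  rw [(h.isOpen k).frontier_eq]
  exact ⟨hyk, hout k hk'⟩

/-- A segment that leaves the `j`-th piece passes through an uncovered part of one of the
frontiers. -/
theorem exists_exit (h : IsCarving B C Y N H) {j : ℕ} {x z : E} (hxj : x ∈ B j)
    (hx : ∀ l < j, x ∉ closure (B l)) (hz : z ∉ B j ∨ ∃ l < j, z ∈ closure (B l)) :
    ∃ y ∈ segment ℝ x z, ∃ k ≤ j, y ∈ frontier (B k) ∧ (∀ l < j, y ∉ B l) ∧
      y ∈ closure (B j) := by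
  -- Leaving the piece means hitting the closure of an earlier set or, at index j, the complement of
  -- `B j`. A first hit is interior to none of these.
  obtain ⟨y, hy, ⟨k, hk, hyk⟩, hint⟩ := exists_first_hit (Finset.range (j + 1))
    (fun l => if l < j then closure (B l) else (B j)ᶜ)
    (fun l _ => by
      split_ifs
      exacts [isClosed_closure, (h.isOpen j).isClosed_compl])
    (x := x) (z := z)
    (fun l _ => by
      split_ifs with hl
      exacts [hx l hl, fun hc => hc hxj])
    (by
      rcases hz with hz | ⟨l, hl, hz⟩
      · exact ⟨j, by simp, by simpa using hz⟩
      · exact ⟨l, by simp; omega, by simpa [hl] using hz⟩)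
  have hout : ∀ l < j, y ∉ B l := by
    intro l hl hyl
    have := hint l (Finset.mem_range.2 (by omega))
    rw [if_pos hl] at this
    exact this (interior_mono subset_closure ((h.isOpen l).interior_eq.symm ▸ hyl))
  have hcl : y ∈ closure (B j) := by
    have := hint j (Finset.mem_range.2 (by omega))
    rw [if_neg (lt_irrefl j), interior_compl] at this
    exact not_not.1 this
  refine ⟨y, hy, k, by have := Finset.mem_range.1 hk; omega, ?_, hout, hcl⟩
  rw [(h.isOpen k).frontier_eq]
  split_ifs at hyk with hkj
  · exact ⟨hyk, hout k hkj⟩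
  · have : k = j := by have := Finset.mem_range.1 hk; omega
    subst this
    exact ⟨hcl, hyk⟩

/-- Suppose the segment from p to x leaves the piece at y, on an uncovered frontier of `B k`. Along
it p stays as near as every additional point, so dist y p ≤ H k y / 50 ≤ dist y p / 50 and y = p,
although no point of `C k` lies on that frontier. -/
theorem mem_of_nearest (h : IsCarving B C Y N H) {Z : Finset E} (hZ : ∀ j, N j ⊆ Z) {j : ℕ}
    {p x : E} (hpC : p ∈ C j) (hpB : p ∈ B j) (hmin : ∀ w ∈ Z, dist x p ≤ dist x w) :
    x ∈ B j ∧ ∀ l < j, x ∉ closure (B l) := by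
  by_contra hcon
  obtain ⟨y, hy, k, hk, hyk, hout, -⟩ := h.exists_exit (z := x) hpB
    (fun l hl => h.notMem_closure_of_lt hl hpC) (by
      by_contra h'
      push Not at h'
      exact hcon h')
  rw [segment_symm] at hy
  obtain ⟨h1, -⟩ := h.dist_le_of_frontier hZ hyk (fun l hl => hout l (by omega))
    (fun w hw => dist_le_dist_of_mem_segment hy (hmin w hw))
  have h2 := h.H_le_dist (h.C_anti hk hpC) y
  have h3 : y = p := dist_le_zero.1 (by linarith)
  exact h.C_frontier k p (h.C_anti hk hpC) (h3 ▸ hyk)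

/-- Points of different pieces are robustly separated. -/
theorem exists_dist_lt (h : IsCarving B C Y N H) {Z : Finset E} (hZ : ∀ j, N j ⊆ Z) {τ : ℝ}
    (hτ : 0 < τ) (hτF : ∀ k, ∀ c ∈ C k, ∀ y ∈ frontier (B k), 2 * τ ≤ dist y c) {i j : ℕ}
    (hij : i ≠ j) {p c x z : E} (hpC : p ∈ C j) (hpB : p ∈ B j) (hcC : c ∈ C i) (hcB : c ∈ B i)
    (hzc : dist z c ≤ τ) (hx : dist x p = dist x z) : ∃ w ∈ Z, dist x w < dist x p := by
  by_contra! hmin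
  obtain ⟨hxB, hxl⟩ := h.mem_of_nearest hZ hpC hpB hmin
  -- If i < j, then z is in `B i` together with c, and x is outside; if j < i, then x is in `B j`
  -- and z is not. Either way the segment crosses an uncovered frontier at a step where c is still
  -- left.
  have hkey : ∃ y ∈ segment ℝ x z, ∃ k, y ∈ frontier (B k) ∧ (∀ l < k, y ∉ B l) ∧ c ∈ C k := by
    rcases lt_or_gt_of_ne hij with hlt | hlt
    · have hzB : z ∈ B i := by
        by_contra hzB
        obtain ⟨y, hy, hyf⟩ := exists_mem_segment_frontier (h.isOpen i) (subset_closure hcB) hzB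
        have h1 := hτF i c hcC y hyf
        have h2 := (dist_le_of_mem_segment hy).1
        rw [dist_comm] at h1
        rw [dist_comm c z] at h2
        linarith
      obtain ⟨y, hy, k, hk, hyk, hout⟩ := h.exists_hit (n := i + 1) (x := x) (z := z)
        (fun l hl => hxl l (by omega)) ⟨i, by omega, subset_closure hzB⟩
      exact ⟨y, hy, k, hyk, fun l hl => hout l (by omega), h.C_anti (by omega) hcC⟩
    · have hzB : z ∉ B j := by
        intro hzB
        obtain ⟨y, hy, hyf⟩ := exists_mem_segment_frontier (h.isOpen j) (subset_closure hzB)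
          (h.notMem_of_lt hlt hcC)
        have h1 := hτF j c (h.C_anti hlt.le hcC) y hyf
        have h2 := (dist_le_of_mem_segment hy).2
        linarith
      obtain ⟨y, hy, k, hk, hyk, hout, -⟩ := h.exists_exit hxB hxl (Or.inl hzB)
      exact ⟨y, hy, k, hyk, fun l hl => hout l (by omega), h.C_anti (by omega) hcC⟩
  obtain ⟨y, hy, k, hyk, hout, hck⟩ := hkey
  -- Contradiction: dist y z ≤ H k y / 50 ≤ dist y c / 50, dist z c ≤ τ ≤ dist y c / 2, and dist y c
  -- is positive.
  obtain ⟨h1, -⟩ := h.dist_le_of_frontier hZ hyk hout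
    (fun w hw => dist_le_dist_of_mem_segment hy (hx ▸ hmin w hw))
  have h2 := h.H_le_dist hck y
  have h3 := hτF k c hck y hyk
  have h4 := dist_triangle y z c
  linarith

/-- The boundary points of the `j`-th piece that are present when it is carved. -/
def IsBoundary (B : ℕ → Set E) (Y N : ℕ → Finset E) (H : ℕ → E → ℝ) (j : ℕ) (w : E) : Prop :=
  w ∈ N j ∨ w ∈ Y j ∧ (w ∈ B j ∨ Near B H j w)

/-- The additional points that touch the `j`-th piece are boundary points of this piece, or they
were added later, close to such a boundary point. -/
theorem isBoundary_or_later (h : IsCarving B C Y N H) {Z : Finset E} (hZ : ∀ j, N j ⊆ Z) {j i : ℕ}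
    {p x z : E} (hpC : p ∈ C j) (hpB : p ∈ B j) (hz : z ∈ N i) (hx : dist x p = dist x z)
    (hmin : ∀ w ∈ Z, dist x p ≤ dist x w) :
    IsBoundary B Y N H j z ∨ j < i ∧ ∃ w, IsBoundary B Y N H j w ∧ dist z w ≤ H j w / 20 := by
  obtain ⟨hxB, hxl⟩ := h.mem_of_nearest hZ hpC hpB hmin
  have hscale : ∀ y ∈ segment ℝ x z, ∀ k, y ∈ frontier (B k) → (∀ l < k, y ∉ B l) →
      dist y z ≤ H k y / 50 ∧ ∃ w, (w ∈ N k ∨ w ∈ Y k) ∧ dist y w ≤ H k y / 50 :=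
    fun y hy k hyk hout => h.dist_le_of_frontier hZ hyk hout
      (fun w hw => dist_le_dist_of_mem_segment hy (hx ▸ hmin w hw))
  rcases lt_trichotomy i j with hij | rfl | hij
  · left
    -- An old point z stays in play up to step j: if it lies in some `B l`, the segment from x to z
    -- crosses an uncovered frontier within the scale of z, so z is near the frontier of `B l` and
    -- is kept.
    have hY : ∀ l, i + 1 ≤ l → l ≤ j → z ∈ Y l := by
      intro l hl
      induction l, hl using Nat.le_induction with
      | base => exact fun _ => (h.Y_succ i z).2 (Or.inr hz)
      | succ l hl ih =>
        intro hlj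
        refine h.mem_Y_succ_of_near (ih (by omega)) fun hzB => ?_
        obtain ⟨y, hy, k, hk, hyk, hout⟩ := h.exists_hit (n := l + 1) (x := x) (z := z)
          (fun l' hl' => hxl l' (by omega)) ⟨l, by omega, subset_closure hzB⟩
        have h1 := (hscale y hy k hyk fun l' hl' => hout l' (by omega)).1
        have h2 := h.lip k y z
        have h3 := h.H_mono z (show k ≤ l by omega)
        refine h.near_of_segment' (hout l (by omega)) hzB ?_
        dsimp only at h3
        linarith [dist_nonneg (x := y) (y := z)]
    refine Or.inr ⟨hY j hij le_rfl, ?_⟩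
    by_cases hzB : z ∈ B j
    · exact Or.inl hzB
    · right
      obtain ⟨y, hy, k, hk, hyk, hout, hcl⟩ := h.exists_exit hxB hxl (Or.inl hzB)
      have h1 := (hscale y hy k hyk fun l' hl' => hout l' (by omega)).1
      have h2 := h.lip k y z
      have h3 := h.H_mono z hk
      refine h.near_of_segment hcl hzB ?_
      dsimp only at h3
      linarith [dist_nonneg (x := y) (y := z)]
  · exact Or.inl (Or.inl hz)
  · right
    obtain ⟨y, hy, k, hk, hyk, hout, hcl⟩ := h.exists_exit hxB hxl (Or.inl (h.N_out i z hz j hij))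
    obtain ⟨h1, w, hw, hyw⟩ := hscale y hy k hyk fun l' hl' => hout l' (by omega)
    have h2 := h.lip k y w
    have h2' := dist_nonneg (x := y) (y := w)
    -- The point w that covers the exit point y is kept up to step j for the same reason, and its
    -- scale does not change meanwhile. Both z and w are within H k y / 50 of y, which gives the
    -- bound H j w / 20.
    have hY : ∀ l, k + 1 ≤ l → l ≤ j → w ∈ Y l ∧ H l w = H k w := by
      intro l hl
      induction l, hl using Nat.le_induction with
      | base =>
        intro _
        have : w ∈ Y (k + 1) := by
          rcases hw with hw | hw
          · exact (h.Y_succ k w).2 (Or.inr hw)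
          · exact h.mem_Y_succ_of_near hw fun _ => ⟨y, hyk, by rw [dist_comm]; linarith⟩
        exact ⟨this, h.H_eq k w this⟩
      | succ l hl ih =>
        intro hlj
        obtain ⟨ih1, ih2⟩ := ih (by omega)
        have : w ∈ Y (l + 1) := h.mem_Y_succ_of_near ih1 fun hwB =>
          h.near_of_segment' (hout l (by omega)) hwB (by linarith)
        exact ⟨this, by rw [h.H_eq l w this, ih2]⟩
    have hwj : (w ∈ N j ∨ w ∈ Y j) ∧ H j w = H k w := by
      rcases hk.eq_or_lt with rfl | hk
      · exact ⟨hw, rfl⟩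
      · exact ⟨Or.inr (hY j hk le_rfl).1, (hY j hk le_rfl).2⟩
    obtain ⟨hwj, hHw⟩ := hwj
    refine ⟨hij, w, ?_, ?_⟩
    · rcases hwj with hwj | hwj
      · exact Or.inl hwj
      · refine Or.inr ⟨hwj, ?_⟩
        by_cases hwB : w ∈ B j
        · exact Or.inl hwB
        · exact Or.inr (h.near_of_segment hcl hwB (by linarith))
    · have := dist_triangle_left z w y
      linarith

/-- The additional points are separated. -/
theorem le_dist_of_mem_N (h : IsCarving B C Y N H) {i i' k : ℕ} (hii : i ≤ i') (hk : k ≤ i)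
    {z z' : E} (hz : z ∈ N i) (hz' : z' ∈ N i') (hne : z ≠ z') : H k z / 100 ≤ dist z z' := by
  have hki : H k z ≤ H i z := h.H_mono z hk
  have hpos := h.N_pos i z hz
  rcases hii.eq_or_lt with rfl | hlt
  · have := (h.N_sep i z hz z' (Or.inl hz') hne.symm).1
    linarith
  -- Either z is still in play when z' is added, and `N_sep` applies, or z was dropped deep inside
  -- some `B l`. As z' avoids `B l`, a frontier point then lies between them.
  · have hY : ∀ l, i + 1 ≤ l → l ≤ i' → z ∈ Y l ∨ H k z / 100 ≤ dist z z' := by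
      intro l hl
      induction l, hl using Nat.le_induction with
      | base => exact fun _ => Or.inl ((h.Y_succ i z).2 (Or.inr hz))
      | succ l hl ih =>
        intro hli
        rcases ih (by omega) with ih | ih
        · by_cases hzY : z ∈ Y (l + 1)
          · exact Or.inl hzY
          · right
            by_contra hlt'
            refine hzY (h.mem_Y_succ_of_near ih fun hzB =>
              h.near_of_segment' (h.N_out i' z' hz' l (by omega)) hzB ?_)
            have h3 : H i z ≤ H l z := h.H_mono z (by omega)
            rw [dist_comm]
            linarith
        · exact Or.inr ih
    rcases hY i' hlt le_rfl with h1 | h1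
    · have h2 := (h.N_sep i' z' hz' z (Or.inr h1) hne).2
      have h3 : H i z ≤ H i' z := h.H_mono z hii
      rw [dist_comm z' z] at h2
      linarith
    · exact h1

end IsCarving

/-! ### Packing and the number of boundary points -/

/-- The number of points of a separated set in a ball. -/
theorem card_le_of_separated_of_dist_le {E : Type*} [NormedAddCommGroup E] [NormedSpace ℝ E]
    [FiniteDimensional ℝ E] {T : Finset E} {w : E} {R s : ℝ} (hR : 0 ≤ R) (hs : 0 < s)
    (hT : ∀ z ∈ T, dist z w ≤ R) (hsep : ∀ z ∈ T, ∀ z' ∈ T, z ≠ z' → s ≤ dist z z') :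
    (T.card : ℝ) ≤ (2 * R / s + 1) ^ Module.finrank ℝ E := by
  borelize E
  let μ : MeasureTheory.Measure E := MeasureTheory.Measure.addHaar
  have hs2 : 0 < s / 2 := by positivity
  have hdis : (T : Set E).PairwiseDisjoint fun z => Metric.ball z (s / 2) := by
    intro z hz z' hz' hne
    exact Metric.ball_disjoint_ball (by linarith [hsep z hz z' hz' hne])
  have hsub : (⋃ z ∈ T, Metric.ball z (s / 2)) ⊆ Metric.closedBall w (R + s / 2) := by
    refine Set.iUnion₂_subset fun z hz => Metric.ball_subset_closedBall.trans
      (Metric.closedBall_subset_closedBall' ?_)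
    linarith [hT z hz]
  have h1 : (T.card : ENNReal) * (ENNReal.ofReal ((s / 2) ^ Module.finrank ℝ E)) *
      μ (Metric.ball 0 1) ≤ ENNReal.ofReal ((R + s / 2) ^ Module.finrank ℝ E) *
        μ (Metric.ball 0 1) := by
    calc _ = μ (⋃ z ∈ T, Metric.ball z (s / 2)) := by
          rw [MeasureTheory.measure_biUnion_finset hdis fun _ _ => measurableSet_ball]
          simp only [μ.addHaar_ball_of_pos _ hs2, Finset.sum_const, nsmul_eq_mul, mul_assoc]
      _ ≤ μ (Metric.closedBall w (R + s / 2)) := MeasureTheory.measure_mono hsub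
      _ = _ := μ.addHaar_closedBall _ (by positivity)
  have h2 : (T.card : ENNReal) * (ENNReal.ofReal ((s / 2) ^ Module.finrank ℝ E)) ≤
      ENNReal.ofReal ((R + s / 2) ^ Module.finrank ℝ E) :=
    (ENNReal.mul_le_mul_iff_left (Metric.measure_ball_pos _ _ zero_lt_one).ne'
      MeasureTheory.measure_ball_lt_top.ne).1 h1
  have h3 : (T.card : ℝ) * (s / 2) ^ Module.finrank ℝ E ≤ (R + s / 2) ^ Module.finrank ℝ E := by
    have := ENNReal.toReal_le_of_le_ofReal (by positivity) h2
    rwa [ENNReal.toReal_mul, ENNReal.toReal_natCast, ENNReal.toReal_ofReal (by positivity)] at this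
  have h4 : 2 * R / s + 1 = (R + s / 2) / (s / 2) := by
    field_simp
  rw [h4, div_pow, le_div_iff₀ (by positivity)]
  exact h3

namespace IsCarving

variable {E : Type*} [NormedAddCommGroup E] {B : ℕ → Set E}
  {C Y N : ℕ → Finset E} {H : ℕ → E → ℝ}

open Classical in
/-- The old points near the frontier of the `j`-th set. -/
noncomputable def nearPoints (B : ℕ → Set E) (Y : ℕ → Finset E) (H : ℕ → E → ℝ) (j : ℕ) :
    Finset E :=
  (Y j).filter fun a => Near B H j a

open Classical in
/-- The boundary points of the `j`-th piece. -/
noncomputable def boundaryPoints (B : ℕ → Set E) (Y N : ℕ → Finset E) (H : ℕ → E → ℝ) (j : ℕ) :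
    Finset E :=
  N j ∪ (Y j).filter fun a => a ∈ B j ∨ Near B H j a

theorem mem_boundaryPoints {j : ℕ} {w : E} :
    w ∈ boundaryPoints B Y N H j ↔ IsBoundary B Y N H j w := by
  simp [boundaryPoints, IsBoundary]

/-- A boundary point that is neither new nor near the frontier leaves `Y` at this step. What leaves
was added before, so these points number at most the sum of the cards of `N` in total. -/
theorem sum_card_boundaryPoints_le (h : IsCarving B C Y N H) (J : ℕ) :
    ∑ j ∈ Finset.range J, (boundaryPoints B Y N H j).card ≤
      2 * ∑ j ∈ Finset.range J, ((N j).card + (nearPoints B Y H j).card) := by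
  classical
  set D : ℕ → Finset E := fun j => (Y j).filter fun a => a ∈ B j ∧ ¬ Near B H j a with hD
  have h1 : ∀ j, (boundaryPoints B Y N H j).card ≤
      (N j).card + (nearPoints B Y H j).card + (D j).card := by
    intro j
    have : boundaryPoints B Y N H j ⊆ N j ∪ nearPoints B Y H j ∪ D j := by
      intro a
      simp only [boundaryPoints, nearPoints, hD, Finset.mem_union, Finset.mem_filter]
      tauto
    refine (Finset.card_le_card this).trans ((Finset.card_union_le _ _).trans ?_)
    gcongr
    exact Finset.card_union_le _ _
  have h2 : ∀ j, (Y (j + 1)).card + (D j).card ≤ (Y j).card + (N j).card := by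
    intro j
    have e : Y (j + 1) = (Y j \ D j) ∪ N j := by
      ext a
      have hDa : a ∈ D j ↔ a ∈ Y j ∧ a ∈ B j ∧ ¬ Near B H j a := Finset.mem_filter
      rw [h.Y_succ, Finset.mem_union, Finset.mem_sdiff, hDa]
      change a ∈ Y j ∧ (a ∉ B j ∨ Near B H j a) ∨ a ∈ N j ↔ _
      tauto
    have h3 := Finset.card_union_le (Y j \ D j) (N j)
    have h4 := Finset.card_sdiff_add_card_eq_card
      (show D j ⊆ Y j from Finset.filter_subset _ _)
    rw [e]
    omega
  have h3 : ∀ J, (Y J).card + ∑ j ∈ Finset.range J, (D j).card ≤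
      ∑ j ∈ Finset.range J, (N j).card := by
    intro J
    induction J with
    | zero => simp [h.Y_zero]
    | succ J ih =>
      rw [Finset.sum_range_succ, Finset.sum_range_succ]
      have := h2 J
      omega
  have h4 := Finset.sum_le_sum fun j (_ : j ∈ Finset.range J) => h1 j
  simp only [Finset.sum_add_distrib] at h4 ⊢
  have h5 := h3 J
  omega

variable [NormedSpace ℝ E] [FiniteDimensional ℝ E]

/-- Few points are added later close to a boundary point. -/
theorem card_later_le (h : IsCarving B C Y N H) {j : ℕ} {w : E} (hw : IsBoundary B Y N H j w)
    {T : Finset E} (hT : ∀ z ∈ T, dist z w ≤ H j w / 20 ∧ ∃ i > j, z ∈ N i) :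
    T.card ≤ 12 ^ Module.finrank ℝ E := by
  have hpos : 0 < H j w := by
    rcases hw with hw | hw
    exacts [h.N_pos j w hw, h.Y_pos hw.1]
  have hHz : ∀ z ∈ T, H j w * (19 / 20) ≤ H j z := by
    intro z hz
    have h1 := h.lip j w z
    have h2 := (hT z hz).1
    rw [dist_comm] at h1
    linarith
  have hle := card_le_of_separated_of_dist_le (T := T) (w := w) (R := H j w / 20)
    (s := H j w * (19 / 20) / 100) (by positivity) (by positivity) (fun z hz => (hT z hz).1) (by
      intro z hz z' hz' hne
      obtain ⟨-, i, hi, hzi⟩ := hT z hz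
      obtain ⟨-, i', hi', hzi'⟩ := hT z' hz'
      rcases le_total i i' with hii | hii
      · have := h.le_dist_of_mem_N hii hi.le hzi hzi' hne
        linarith [hHz z hz]
      · have := h.le_dist_of_mem_N hii hi'.le hzi' hzi hne.symm
        rw [dist_comm] at this
        linarith [hHz z' hz'])
  -- The ratio is 200/19 + 1, about 11.5.
  have h3 : 2 * (H j w / 20) / (H j w * (19 / 20) / 100) + 1 ≤ 12 := by
    rw [← le_sub_iff_add_le, div_le_iff₀ (by positivity)]
    linarith
  have h4 : (T.card : ℝ) ≤ (12 : ℝ) ^ Module.finrank ℝ E :=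
    hle.trans (pow_le_pow_left₀ (by positivity) h3 _)
  exact_mod_cast h4

theorem card_touchingPoints_le (h : IsCarving B C Y N H) {C₀ Z : Finset E} (hZ : ∀ j, N j ⊆ Z)
    (hZN : ∀ z ∈ Z, ∃ i, z ∈ N i) {f : E → ℕ} (hf : ∀ c ∈ C₀, c ∈ C (f c) ∧ c ∈ B (f c)) (j : ℕ) :
    (touchingPoints f C₀ Z j).card ≤
      (1 + 12 ^ Module.finrank ℝ E) * (boundaryPoints B Y N H j).card := by
  classical
  set M := boundaryPoints B Y N H j with hM
  have hsub : touchingPoints f C₀ Z j ⊆ M ∪ M.biUnion fun w =>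
      Z.filter fun z => dist z w ≤ H j w / 20 ∧ ∃ i > j, z ∈ N i := by
    intro z hz
    obtain ⟨hzZ, p, hp, rfl, x, hx, hmin⟩ := Finset.mem_filter.1 hz
    obtain ⟨i, hi⟩ := hZN z hzZ
    rcases h.isBoundary_or_later hZ (hf p hp).1 (hf p hp).2 hi hx hmin with h1 | ⟨h1, w, hw, hd⟩
    · exact Finset.mem_union_left _ (mem_boundaryPoints.2 h1)
    · exact Finset.mem_union_right _ (Finset.mem_biUnion.2
        ⟨w, mem_boundaryPoints.2 hw, Finset.mem_filter.2 ⟨hzZ, hd, i, h1, hi⟩⟩)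
  refine (Finset.card_le_card hsub).trans ((Finset.card_union_le _ _).trans ?_)
  rw [add_mul, one_mul, mul_comm (12 ^ _)]
  gcongr
  refine Finset.card_biUnion_le_card_mul _ _ _ fun w hw => ?_
  exact h.card_later_le (mem_boundaryPoints.1 hw) fun z hz => (Finset.mem_filter.1 hz).2

end IsCarving

/-! ### Choosing a radius by averaging -/

section RadiusSelection

open MeasureTheory Metric

variable {E : Type*} [NormedAddCommGroup E] [NormedSpace ℝ E] [FiniteDimensional ℝ E]

section Measure

variable [MeasurableSpace E] [BorelSpace E] (μ : Measure E) [μ.IsAddHaarMeasure]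

/-- The integral of `‖x‖ ^ (1 - n)` over a ball. -/
theorem lintegral_inv_dist_pow_le (hn : 1 ≤ Module.finrank ℝ E) (a : E) {s : ℝ} (hs : 0 < s) :
    ∫⁻ x in ball a s, ENNReal.ofReal ((dist x a ^ (Module.finrank ℝ E - 1))⁻¹) ∂μ ≤
      ENNReal.ofReal (Module.finrank ℝ E * μ.real (ball 0 1) * s) := by
  have : Nontrivial E := Module.nontrivial_of_finrank_pos (R := ℝ) (by omega)
  set n := Module.finrank ℝ E with hnE
  set f : ℝ → ℝ := (Set.Iio s).indicator fun y => (y ^ (n - 1))⁻¹ with hf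
  have h1 : ∫⁻ x in ball a s, ENNReal.ofReal ((dist x a ^ (n - 1))⁻¹) ∂μ =
      ∫⁻ x, ENNReal.ofReal (f ‖x‖) ∂μ := by
    rw [← lintegral_indicator measurableSet_ball, ← lintegral_sub_right_eq_self (fun x => ENNReal.ofReal (f ‖x‖)) a]
    refine lintegral_congr fun x => ?_
    rw [hf]
    by_cases hx : dist x a < s
    · rw [Set.indicator_of_mem (by simpa using hx), Set.indicator_of_mem (by
        simpa [dist_eq_norm] using hx), dist_eq_norm]
    · rw [Set.indicator_of_notMem (by simpa using hx), Set.indicator_of_notMem (by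
        simpa [dist_eq_norm] using hx), ENNReal.ofReal_zero]
  have hprod : ∀ y ∈ Set.Ioi (0 : ℝ), y ^ (n - 1) • f y = (Set.Iio s).indicator (fun _ => (1 : ℝ)) y := by
    intro y hy
    have hy' : (0 : ℝ) < y := hy
    by_cases hys : y < s
    · rw [hf, Set.indicator_of_mem (by simpa using hys), Set.indicator_of_mem (by simpa using hys),
        smul_eq_mul, mul_inv_cancel₀ (by positivity)]
    · rw [hf, Set.indicator_of_notMem (by simpa using hys),
        Set.indicator_of_notMem (by simpa using hys), smul_zero]
  have hint1 : IntegrableOn ((Set.Iio s).indicator (fun _ => (1 : ℝ))) (Set.Ioi 0) := by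
    rw [IntegrableOn, integrable_indicator_iff measurableSet_Iio, IntegrableOn,
      Measure.restrict_restrict measurableSet_Iio, Set.Iio_inter_Ioi]
    exact integrableOn_const (by simp)
  have hint : Integrable (fun x : E => f ‖x‖) μ := by
    rw [integrable_fun_norm_addHaar, integrableOn_congr_fun hprod measurableSet_Ioi]
    exact hint1
  have hnonneg : ∀ x : E, 0 ≤ f ‖x‖ := fun x => by
    rw [hf]
    exact Set.indicator_apply_nonneg fun _ => by positivity
  rw [h1, ← ofReal_integral_eq_lintegral_ofReal hint (Filter.Eventually.of_forall hnonneg),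
    integral_fun_norm_addHaar, setIntegral_congr_fun measurableSet_Ioi hprod,
    setIntegral_indicator measurableSet_Iio, Set.Ioi_inter_Iio]
  refine ENNReal.ofReal_le_ofReal (le_of_eq ?_)
  simp [hs.le, mul_assoc, hnE]

/-- The integral of the `(1 - n)`-th power of a function that is at least the distance to a finite
set. -/
theorem lintegral_inv_pow_le (hn : 1 ≤ Module.finrank ℝ E) {A : Finset E} {H : E → ℝ}
    (hA : ∀ x, ∃ a ∈ A, dist x a ≤ H x) {c : E} {ρ s : ℝ} (hρ : 0 < ρ) (hs : 0 < s)
    (hsρ : s ≤ 20 * ρ) {k : ℕ}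
    (hk : ∀ A' ⊆ A, (∀ a ∈ A', dist a c ≤ 40 * ρ) → A'.card ≤ k) :
    ∫⁻ x in ball c (20 * ρ), ENNReal.ofReal ((H x ^ (Module.finrank ℝ E - 1))⁻¹) ∂μ ≤
      ENNReal.ofReal (μ.real (ball 0 1) * ((s ^ (Module.finrank ℝ E - 1))⁻¹ *
        (20 * ρ) ^ Module.finrank ℝ E + k * Module.finrank ℝ E * s)) := by
  classical
  have : Nontrivial E := Module.nontrivial_of_finrank_pos (R := ℝ) (by omega)
  set n := Module.finrank ℝ E with hnE
  set A' := A.filter fun a => dist a c ≤ 40 * ρ with hA'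
  have hA'k : A'.card ≤ k := hk A' (Finset.filter_subset _ _) fun a ha => (Finset.mem_filter.1 ha).2
  set g : E → E → ENNReal := fun a =>
    (ball a s).indicator fun x => ENNReal.ofReal ((dist x a ^ (n - 1))⁻¹) with hg
  have hgm : ∀ a, Measurable (g a) := by
    intro a
    refine Measurable.indicator ?_ measurableSet_ball
    fun_prop
  -- Where H ≥ s the integrand is at most s^(1-n). Where H < s, some a in A has dist x a ≤ H x < s,
  -- and a lies within 40ρ of c. The finite set A is null.
  have hpt : ∀ᵐ x ∂μ.restrict (ball c (20 * ρ)), ENNReal.ofReal ((H x ^ (n - 1))⁻¹) ≤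
      ENNReal.ofReal ((s ^ (n - 1))⁻¹) + ∑ a ∈ A', g a x := by
    have hne : ∀ᵐ x ∂μ.restrict (ball c (20 * ρ)), x ∉ (A : Set E) :=
      ae_restrict_of_ae (measure_eq_zero_iff_ae_notMem.1 (A.finite_toSet.measure_zero μ))
    filter_upwards [hne, ae_restrict_mem measurableSet_ball] with x hxA hx
    rcases le_or_gt s (H x) with h | h
    · refine le_add_right (ENNReal.ofReal_le_ofReal ?_)
      gcongr
    · refine le_add_left ?_
      obtain ⟨a, ha, hxa⟩ := hA x
      have hd : 0 < dist x a := by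
        refine dist_pos.2 ?_
        rintro rfl
        exact hxA ha
      have haA' : a ∈ A' := by
        refine Finset.mem_filter.2 ⟨ha, ?_⟩
        have := dist_triangle_left a c x
        rw [mem_ball] at hx
        linarith
      have hga : g a x = ENNReal.ofReal ((dist x a ^ (n - 1))⁻¹) :=
        Set.indicator_of_mem (mem_ball.2 (hxa.trans_lt h)) _
      calc ENNReal.ofReal ((H x ^ (n - 1))⁻¹) ≤ g a x := by
            rw [hga]
            refine ENNReal.ofReal_le_ofReal ?_
            gcongr
        _ ≤ _ := Finset.single_le_sum (f := fun a => g a x) (fun _ _ => zero_le) haA'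
  calc _ ≤ ∫⁻ x in ball c (20 * ρ), (ENNReal.ofReal ((s ^ (n - 1))⁻¹) + ∑ a ∈ A', g a x) ∂μ :=
        lintegral_mono_ae hpt
    _ = ENNReal.ofReal ((s ^ (n - 1))⁻¹) * μ (ball c (20 * ρ)) +
        ∑ a ∈ A', ∫⁻ x in ball c (20 * ρ), g a x ∂μ := by
      rw [lintegral_add_left measurable_const, setLIntegral_const,
        lintegral_finsetSum _ fun a _ => hgm a]
    _ ≤ ENNReal.ofReal ((s ^ (n - 1))⁻¹) *
          (ENNReal.ofReal ((20 * ρ) ^ n) * ENNReal.ofReal (μ.real (ball 0 1))) +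
        ∑ a ∈ A', ENNReal.ofReal (n * μ.real (ball 0 1) * s) := by
      have hb : μ (ball c (20 * ρ)) =
          ENNReal.ofReal ((20 * ρ) ^ n) * ENNReal.ofReal (μ.real (ball 0 1)) := by
        rw [μ.addHaar_ball_of_pos _ (by positivity), Measure.real,
          ENNReal.ofReal_toReal measure_ball_lt_top.ne]
      rw [hb]
      gcongr with a ha
      refine (setLIntegral_le_lintegral _ _).trans ?_
      rw [lintegral_indicator measurableSet_ball]
      exact lintegral_inv_dist_pow_le μ hn a hs
    _ ≤ _ := by
      have hω : 0 ≤ μ.real (ball (0 : E) 1) := measureReal_nonneg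
      rw [Finset.sum_const, nsmul_eq_mul, ← ENNReal.ofReal_natCast, ← ENNReal.ofReal_mul (by positivity),
        ← ENNReal.ofReal_mul (by positivity), ← ENNReal.ofReal_mul (by positivity),
        ← ENNReal.ofReal_add (by positivity) (by positivity)]
      refine ENNReal.ofReal_le_ofReal ?_
      have : (A'.card : ℝ) * (n * μ.real (ball (0 : E) 1) * s) ≤
          k * (n * μ.real (ball (0 : E) 1) * s) := by gcongr
      linarith

/-- The mass close to the sphere of radius `t`, in units of the local scale `H`. -/
noncomputable def shellMass (H : E → ℝ) (c : E) (ρ t : ℝ) : ENNReal :=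
  ∫⁻ x in ball c (20 * ρ), Set.indicator {q : ℝ × E | |dist q.2 c - q.1| ≤ 3 / 25 * H q.2}
    (fun q => ENNReal.ofReal ((H q.2 ^ Module.finrank ℝ E)⁻¹)) (t, x) ∂μ

theorem measurable_shell {H : E → ℝ} (hH : Continuous H) (c : E) :
    Measurable (Set.indicator {q : ℝ × E | |dist q.2 c - q.1| ≤ 3 / 25 * H q.2}
      (fun q => ENNReal.ofReal ((H q.2 ^ Module.finrank ℝ E)⁻¹))) := by
  refine Measurable.indicator ?_ ?_
  · have : Measurable H := hH.measurable
    fun_prop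
  · exact (isClosed_le (by fun_prop) (by fun_prop)).measurableSet

/-- By Tonelli: a point x counts for radii t in an interval of length (6/25) H(x), so one factor of
H^(-n) cancels. -/
theorem lintegral_shellMass_le (hn : 1 ≤ Module.finrank ℝ E) {H : E → ℝ} (hH : Continuous H)
    (hH0 : ∀ x, 0 ≤ H x) (c : E) (ρ : ℝ) (S : Set ℝ) :
    ∫⁻ t in S, shellMass μ H c ρ t ≤
      ∫⁻ x in ball c (20 * ρ), ENNReal.ofReal ((H x ^ (Module.finrank ℝ E - 1))⁻¹) ∂μ := by
  unfold shellMass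
  rw [lintegral_lintegral_swap (f := fun t x => Set.indicator
    {q : ℝ × E | |dist q.2 c - q.1| ≤ 3 / 25 * H q.2}
    (fun q => ENNReal.ofReal ((H q.2 ^ Module.finrank ℝ E)⁻¹)) (t, x))
    (measurable_shell hH c).aemeasurable]
  refine lintegral_mono fun x => ?_
  have h1 : ∀ t : ℝ, Set.indicator {q : ℝ × E | |dist q.2 c - q.1| ≤ 3 / 25 * H q.2}
      (fun q => ENNReal.ofReal ((H q.2 ^ Module.finrank ℝ E)⁻¹)) (t, x) =
      (closedBall (dist x c) (3 / 25 * H x)).indicator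
        (fun _ => ENNReal.ofReal ((H x ^ Module.finrank ℝ E)⁻¹)) t := by
    intro t
    by_cases h : |dist x c - t| ≤ 3 / 25 * H x
    · rw [Set.indicator_of_mem (by exact h), Set.indicator_of_mem (by
        rw [mem_closedBall, Real.dist_eq, abs_sub_comm]; exact h)]
    · rw [Set.indicator_of_notMem (by exact h), Set.indicator_of_notMem (by
        rw [mem_closedBall, Real.dist_eq, abs_sub_comm]; exact h)]
  simp_rw [h1]
  refine (setLIntegral_le_lintegral _ _).trans ?_
  rw [lintegral_indicator measurableSet_closedBall, setLIntegral_const, Real.volume_closedBall,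
    ← ENNReal.ofReal_mul (by have := hH0 x; positivity)]
  refine ENNReal.ofReal_le_ofReal ?_
  rcases (hH0 x).eq_or_lt with h0 | h0
  · rw [← h0]
    simp
  · obtain ⟨m, hm⟩ : ∃ m, Module.finrank ℝ E = m + 1 := ⟨Module.finrank ℝ E - 1, by omega⟩
    rw [hm, Nat.add_sub_cancel, pow_succ, mul_inv, mul_assoc]
    have h2 : (H x)⁻¹ * (2 * (3 / 25 * H x)) ≤ 1 := by
      have : (H x)⁻¹ * (2 * (3 / 25 * H x)) = 6 / 25 := by
        field_simp
        norm_num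
      rw [this]
      norm_num
    have h3 : 0 ≤ (H x ^ m)⁻¹ := by positivity
    nlinarith

/-- The balls of radius H(u)/400 around the points of `T` are disjoint and lie in the shell, since H
varies little on them; as H ≤ 2H(u) there, each contributes at least the volume of the unit ball
times 800^(-n). -/
theorem card_mul_le_shellMass {H : E → ℝ} (hlip : ∀ x y, H x ≤ H y + dist x y) {c : E} {ρ t : ℝ}
    (T : Finset E) (hpos : ∀ u ∈ T, 0 < H u) (hball : ∀ u ∈ T, dist u c + H u / 400 ≤ 20 * ρ)
    (hnear : ∀ u ∈ T, |dist u c - t| ≤ H u / 10)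
    (hsep : ∀ u ∈ T, ∀ v ∈ T, u ≠ v → H u / 100 ≤ dist u v) :
    ENNReal.ofReal (T.card * (μ.real (ball (0 : E) 1) * (1 / 800) ^ Module.finrank ℝ E)) ≤
      shellMass μ H c ρ t := by
  set n := Module.finrank ℝ E with hnE
  have hdis : (T : Set E).PairwiseDisjoint fun z => ball z (H z / 400) := by
    intro z hz z' hz' hne
    have h1 := hsep z hz z' hz' hne
    have h2 := hsep z' hz' z hz hne.symm
    rw [dist_comm] at h2
    exact ball_disjoint_ball (by linarith [hpos z hz, hpos z' hz'])
  have hsub : (⋃ z ∈ T, ball z (H z / 400)) ⊆ ball c (20 * ρ) :=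
    Set.iUnion₂_subset fun z hz => ball_subset_ball' (by linarith [hball z hz])
  have hω : 0 ≤ μ.real (ball (0 : E) 1) := measureReal_nonneg
  unfold shellMass
  refine le_trans ?_ (lintegral_mono_set hsub)
  rw [lintegral_biUnion_finset hdis fun _ _ => measurableSet_ball, ENNReal.ofReal_mul (by positivity),
    ENNReal.ofReal_natCast, ← nsmul_eq_mul]
  refine Finset.card_nsmul_le_sum _ _ _ fun u hu => ?_
  have hu0 := hpos u hu
  have hlow : ∀ x ∈ ball u (H u / 400), ENNReal.ofReal (((2 * H u) ^ n)⁻¹) ≤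
      Set.indicator {q : ℝ × E | |dist q.2 c - q.1| ≤ 3 / 25 * H q.2}
        (fun q => ENNReal.ofReal ((H q.2 ^ n)⁻¹)) (t, x) := by
    intro x hx
    rw [mem_ball] at hx
    have h1 := hlip x u
    have h2 := hlip u x
    rw [dist_comm] at h2
    rw [Set.indicator_of_mem]
    · refine ENNReal.ofReal_le_ofReal ?_
      have : 0 < H x := by linarith
      dsimp only
      gcongr
      linarith
    · change |dist x c - t| ≤ 3 / 25 * H x
      have h3 := abs_le.1 (hnear u hu)
      have h4 := dist_triangle x u c
      have h5 := dist_triangle_left u c x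
      rw [abs_le]
      constructor <;> linarith
  refine le_trans ?_ (setLIntegral_mono' measurableSet_ball hlow)
  rw [setLIntegral_const, μ.addHaar_ball_of_pos _ (by positivity : 0 < H u / 400),
    ← ENNReal.ofReal_toReal (measure_ball_lt_top (μ := μ) (x := (0 : E)) (r := 1)).ne,
    ← ENNReal.ofReal_mul (by positivity), ← ENNReal.ofReal_mul (by positivity)]
  refine ENNReal.ofReal_le_ofReal (le_of_eq ?_)
  change _ = _ * (_ * μ.real (ball (0 : E) 1))
  have : ((2 * H u) ^ n)⁻¹ * (H u / 400) ^ n = (1 / 800) ^ n := by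
    rw [← inv_pow, ← mul_pow]
    congr 1
    field_simp
    norm_num
  rw [← mul_assoc, this, mul_comm]

end Measure

/-- There is a sphere near which a separated set with respect to the local scale `H` has few
points. -/
theorem exists_radius (hn : 1 ≤ Module.finrank ℝ E) {A : Finset E} {H : E → ℝ}
    (hlip : ∀ x y, H x ≤ H y + dist x y)
    (hA : ∀ x, ∃ a ∈ A, dist x a ≤ H x) {c : E} {ρ ν : ℝ} (hρ : 0 < ρ) (hν : 1 ≤ ν) {k : ℕ}
    (hk : ∀ A' ⊆ A, (∀ a ∈ A', dist a c ≤ 40 * ρ) → A'.card ≤ k) (bad : Finset ℝ) :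
    ∃ t, ρ < t ∧ t ≤ 2 * ρ ∧ t ∉ bad ∧ ∀ T : Finset E, (∀ u ∈ T, 0 < H u) →
      (∀ u ∈ T, dist u c + H u / 400 ≤ 20 * ρ) → (∀ u ∈ T, |dist u c - t| ≤ H u / 10) →
      (∀ u ∈ T, ∀ v ∈ T, u ≠ v → H u / 100 ≤ dist u v) →
      (T.card : ℝ) ≤ 800 ^ Module.finrank ℝ E * (20 ^ Module.finrank ℝ E *
        ν ^ (Module.finrank ℝ E - 1) + k * Module.finrank ℝ E / ν) := by
  borelize E
  let μ : Measure E := Measure.addHaar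
  have hcont : Continuous H := by
    refine (LipschitzWith.of_le_add fun x y => hlip x y).continuous
  have hH0 : ∀ x, 0 ≤ H x := fun x => by
    obtain ⟨a, -, ha⟩ := hA x
    exact dist_nonneg.trans ha
  set S : Set ℝ := Set.Ioc ρ (2 * ρ) \ bad with hS
  have hSvol : volume S = ENNReal.ofReal ρ := by
    rw [hS, measure_sdiff_null (bad.finite_toSet.measure_zero _), Real.volume_Ioc]
    congr 1
    ring
  have hmeas : Measurable (shellMass μ H c ρ) := (measurable_shell hcont c).lintegral_prod_right'
  obtain ⟨t, ⟨⟨ht1, ht2⟩, htb⟩, ht⟩ := exists_le_setLAverage (μ := volume) (s := S)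
    (f := shellMass μ H c ρ) (by rw [hSvol]; simpa using hρ) (by rw [hSvol]; simp)
    hmeas.aemeasurable
  refine ⟨t, ht1, ht2, htb, fun T hpos hball hnear hsep => ?_⟩
  have hν0 : 0 < ν := by linarith
  have h1 := (card_mul_le_shellMass μ hlip T hpos hball hnear hsep).trans ht
  -- With s = ρ/ν both terms are of order ρ ν^(n-1) once k is of order ν^n, as it is in the
  -- application.
  have h2 := (lintegral_shellMass_le μ hn hcont hH0 c ρ S).trans
    (lintegral_inv_pow_le μ hn hA hρ (s := ρ / ν) (by positivity)
      (by rw [div_le_iff₀ hν0]; nlinarith) hk)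
  rw [setLAverage_eq, hSvol] at h1
  set n := Module.finrank ℝ E with hnE
  set ω := μ.real (ball (0 : E) 1) with hω
  have hω0 : 0 < ω := by
    rw [hω, Measure.real]
    exact ENNReal.toReal_pos (measure_ball_pos _ _ one_pos).ne' measure_ball_lt_top.ne
  have h3 := h1.trans (ENNReal.div_le_div_right h2 _)
  rw [← ENNReal.ofReal_div_of_pos hρ, ENNReal.ofReal_le_ofReal_iff (by positivity),
    le_div_iff₀ hρ] at h3
  obtain ⟨m, hm⟩ : ∃ m, n = m + 1 := ⟨n - 1, by omega⟩
  have h4 : ((ρ / ν) ^ (n - 1))⁻¹ * (20 * ρ) ^ n + k * n * (ρ / ν) =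
      ρ * (20 ^ n * ν ^ (n - 1) + k * n / ν) := by
    rw [hm, Nat.add_sub_cancel, div_pow, mul_pow]
    field_simp
    ring
  rw [h4] at h3
  have h5 : (T.card : ℝ) * (1 / 800) ^ n ≤ 20 ^ n * ν ^ (n - 1) + k * n / ν := by
    refine le_of_mul_le_mul_left ?_ (mul_pos hω0 hρ)
    linarith
  rw [one_div, inv_pow, ← div_eq_mul_inv, div_le_iff₀ (by positivity)] at h5
  linarith

end RadiusSelection

/-! ### Nets, scale functions and minimal balls -/

theorem exists_card_maximal {α : Type*} (P : Finset α → Prop) (h₀ : P ∅) (K : ℕ)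
    (hK : ∀ N, P N → N.card ≤ K) : ∃ N, P N ∧ ∀ N', P N' → N'.card ≤ N.card := by
  obtain ⟨N, hN, hmax⟩ := Nat.sSup_mem (s := Finset.card '' {N | P N}) ⟨_, ∅, h₀, rfl⟩
    ⟨K, by rintro _ ⟨N, hN, rfl⟩; exact hK N hN⟩
  refine ⟨N, hN, fun N' hN' => ?_⟩
  rw [hmax]
  exact le_csSup ⟨K, by rintro _ ⟨N, hN, rfl⟩; exact hK N hN⟩ ⟨N', hN', rfl⟩

section Scale

variable {E : Type*} [NormedAddCommGroup E]

theorem exists_separated_net (A : Finset E) (ρ : ℝ) :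
    ∃ T ⊆ A, (∀ z ∈ T, ∀ z' ∈ T, z ≠ z' → ρ ≤ dist z z') ∧ ∀ x ∈ A, x ∈ T ∨ ∃ a ∈ T, dist x a < ρ := by
  classical
  obtain ⟨T, ⟨hTA, hT⟩, hmax⟩ := exists_card_maximal
    (fun T : Finset E => T ⊆ A ∧ ∀ z ∈ T, ∀ z' ∈ T, z ≠ z' → ρ ≤ dist z z') (by simp) A.card
    (fun N hN => Finset.card_le_card hN.1)
  refine ⟨T, hTA, hT, fun x hx => ?_⟩
  by_contra! hcon
  obtain ⟨hxT, hfar⟩ := hcon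
  have := hmax (insert x T) ⟨Finset.insert_subset hx hTA, by
    intro z hz z' hz' hne
    rcases Finset.mem_insert.1 hz with h | h <;> rcases Finset.mem_insert.1 hz' with h' | h'
    · exact absurd (h.trans h'.symm) hne
    · exact h ▸ hfar z' h'
    · rw [dist_comm]
      exact h' ▸ hfar z h
    · exact hT z h z' h' hne⟩
  rw [Finset.card_insert_of_notMem hxT] at this
  omega

/-- The largest extension of a scale function from a finite set of points. -/
theorem exists_scale_extension (A : Finset E) (H : E → ℝ) (hlip : ∀ x y, H x ≤ H y + dist x y)
    (hH : ∀ x, 0 ≤ H x) :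
    ∃ H' : E → ℝ, (∀ x y, H' x ≤ H' y + dist x y) ∧ (∀ x, H x ≤ H' x) ∧ (∀ a ∈ A, H' a = H a) ∧
      (A.Nonempty → ∀ x, ∃ a ∈ A, dist x a ≤ H' x) := by
  rcases A.eq_empty_or_nonempty with rfl | hA
  · exact ⟨H, hlip, fun _ => le_rfl, by simp, by simp⟩
  -- The McShane extension of `H` from `A`; it is at least the distance to `A` because `H` is
  -- nonnegative.
  set H' : E → ℝ := fun x => A.inf' hA fun a => H a + dist x a with hH'
  have hatt : ∀ x, ∃ a ∈ A, H' x = H a + dist x a := fun x => A.exists_mem_eq_inf' hA _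
  have hle : ∀ x, ∀ a ∈ A, H' x ≤ H a + dist x a := fun x a ha =>
    A.inf'_le (fun a => H a + dist x a) ha
  have hge : ∀ x, H x ≤ H' x := by
    intro x
    obtain ⟨a, -, h⟩ := hatt x
    rw [h]
    exact hlip x a
  refine ⟨H', ?_, hge, ?_, ?_⟩
  · intro x y
    obtain ⟨a, ha, h⟩ := hatt y
    have h1 := hle x a ha
    have h2 := dist_triangle x y a
    linarith
  · intro a ha
    have := hle a a ha
    rw [dist_self, add_zero] at this
    exact le_antisymm this (hge a)
  · intro _ x
    obtain ⟨a, ha, h⟩ := hatt x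
    exact ⟨a, ha, by linarith [hH a]⟩

/-- A ball around a point of `A` of minimal radius among those with `m` points of `A`. -/
theorem exists_minimal_ball {A : Finset E} {m : ℕ} (hm : 2 ≤ m) (hA : m ≤ A.card) :
    ∃ c ∈ A, ∃ ρ : ℝ, 0 < ρ ∧ (∃ F ⊆ A, m ≤ F.card ∧ ∀ x ∈ F, dist x c ≤ ρ) ∧
      ∀ a ∈ A, ∀ F ⊆ A, (∀ x ∈ F, dist x a < ρ) → F.card ≤ m := by
  classical
  -- Only distances between points of `A` need be tried as radii, so a minimum exists.
  set I := (A ×ˢ A).filter fun q => m ≤ (A.filter fun x => dist x q.1 ≤ dist q.2 q.1).card with hI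
  have key : ∀ a ∈ A, ∀ F ⊆ A, m ≤ F.card → ∃ a' ∈ F, (a, a') ∈ I := by
    intro a ha F hF hmF
    have hFne : F.Nonempty := Finset.card_pos.1 (by omega)
    obtain ⟨a', ha', hmax⟩ := F.exists_max_image (fun x => dist x a) hFne
    refine ⟨a', ha', Finset.mem_filter.2 ⟨Finset.mk_mem_product ha (hF ha'), hmF.trans ?_⟩⟩
    exact Finset.card_le_card fun x hx => Finset.mem_filter.2 ⟨hF hx, hmax x hx⟩
  obtain ⟨a₀, ha₀⟩ : A.Nonempty := Finset.card_pos.1 (by omega)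
  obtain ⟨a₁, -, h₁⟩ := key a₀ ha₀ A subset_rfl hA
  obtain ⟨⟨c, c'⟩, hc, hmin⟩ := I.exists_min_image (fun q => dist q.2 q.1) ⟨_, h₁⟩
  obtain ⟨hcc, hcm⟩ := Finset.mem_filter.1 hc
  have hcA := (Finset.mem_product.1 hcc).1
  dsimp only at hcm hcA
  refine ⟨c, hcA, dist c' c, ?_, ⟨_, Finset.filter_subset _ _, hcm, ?_⟩, ?_⟩
  · by_contra hcon
    have h0 : dist c' c = 0 := le_antisymm (not_lt.1 hcon) dist_nonneg
    rw [h0] at hcm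
    have : (A.filter fun x => dist x c ≤ 0) ⊆ {c} := by
      intro x hx
      exact Finset.mem_singleton.2 (dist_le_zero.1 (Finset.mem_filter.1 hx).2)
    have := Finset.card_le_card this
    rw [Finset.card_singleton] at this
    omega
  · exact fun x hx => (Finset.mem_filter.1 hx).2
  · intro a ha F hF hlt
    by_contra hcon
    obtain ⟨a', ha', hI'⟩ := key a ha F hF (by omega)
    exact absurd (hmin _ hI') (not_le.2 (hlt a' ha'))

end Scale

/-! ### A single carving step -/

/-- The state in the carving process: the part `U` of the space that has been carved out, the
original points `C` and the additional points `Y` that are left, and the local scale `H`. -/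
structure CarvingState (E : Type*) [NormedAddCommGroup E] where
  U : Set E
  C : Finset E
  Y : Finset E
  H : E → ℝ
  lip : ∀ x y, H x ≤ H y + dist x y
  nonneg : ∀ x, 0 ≤ H x
  zero : ∀ c ∈ C, H c ≤ 0
  pos : ∀ a ∈ Y, 0 < H a
  sep : ∀ u ∈ Y, ∀ v ∈ Y, u ≠ v → H u / 100 ≤ dist u v
  near : (∃ a, a ∈ C ∨ a ∈ Y) → ∀ x, ∃ a, (a ∈ C ∨ a ∈ Y) ∧ dist x a ≤ H x

/-- The open set `B` and the points `N` on its frontier lead from the state `s` to `s'`. -/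
structure IsCarvingStep {E : Type*} [NormedAddCommGroup E] (P : ℕ) (γ : ℝ) (s s' : CarvingState E)
    (B : Set E) (N : Finset E) : Prop where
  isOpen : IsOpen B
  C_frontier : ∀ c ∈ s.C, c ∉ frontier B
  C_succ : ∀ c, c ∈ s'.C ↔ c ∈ s.C ∧ c ∉ B
  Y_succ : ∀ a, a ∈ s'.Y ↔
    (a ∈ s.Y ∧ (a ∉ B ∨ ∃ y ∈ frontier B, dist a y ≤ s.H a / 10)) ∨ a ∈ N
  U_succ : s'.U = s.U ∪ B
  N_frontier : ∀ z ∈ N, z ∈ frontier B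
  N_out : ∀ z ∈ N, z ∉ s.U
  N_pos : ∀ z ∈ N, 0 < s.H z
  N_sep : ∀ z ∈ N, ∀ a, a ∈ N ∨ a ∈ s.Y → a ≠ z →
    s.H z / 100 ≤ dist z a ∧ s.H a / 100 ≤ dist z a
  cover : ∀ y ∈ frontier B, y ∉ s.U → ∃ w, (w ∈ N ∨ w ∈ s.Y) ∧ dist y w ≤ s.H y / 50
  mono : ∀ x, s.H x ≤ s'.H x
  H_eq : ∀ a ∈ s'.Y, s'.H a = s.H a
  card_C : ∀ F ⊆ s.C, (∀ c ∈ F, c ∈ B) → F.card ≤ P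
  card_boundary : ∀ W ⊆ s.Y, (∀ a ∈ W, ∃ y ∈ frontier B, dist a y ≤ s.H a / 10) →
    ((N.card + W.card : ℕ) : ℝ) ≤ γ * ((s.C.card + s.Y.card : ℕ) - (s'.C.card + s'.Y.card : ℕ))
  decrease : s'.C.card + s'.Y.card ≤ s.C.card + s.Y.card - 1

namespace CarvingState

variable {E : Type*} [NormedAddCommGroup E]

/-- If few points are left, the process is finished in one step. -/
theorem exists_last_step (s : CarvingState E) {P : ℕ} {γ : ℝ} (hγ : 0 ≤ γ)
    (hP : s.C.card + s.Y.card ≤ P) : ∃ s' B N, IsCarvingStep P γ s s' B N := by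
  -- The last piece is the whole space: its frontier is empty and needs no points.
  refine ⟨⟨Set.univ, ∅, ∅, s.H, s.lip, s.nonneg, by simp, by simp, by simp, by simp⟩, Set.univ, ∅,
    ⟨isOpen_univ, by simp, by simp, by simp, by simp, by simp, by simp, by simp, by simp, by simp,
    fun _ => le_rfl, by simp, ?_, ?_, by simp⟩⟩
  · intro F hF _
    have := Finset.card_le_card hF
    omega
  · intro W _ hW
    have : W = ∅ := Finset.eq_empty_of_forall_notMem fun a ha => by simpa using hW a ha
    simp [this]
    positivity

theorem disjoint (s : CarvingState E) : Disjoint s.C s.Y :=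
  Finset.disjoint_left.2 fun a hC hY => absurd (s.zero a hC) (not_le.2 (s.pos a hY))

/-- The state after carving out the open set `B` and adding the points `N`. -/
theorem exists_next (s : CarvingState E) (B : Set E) (N : Finset E) (hpos : ∀ z ∈ N, 0 < s.H z)
    (hsep : ∀ z ∈ N, ∀ a, a ∈ N ∨ a ∈ s.Y → a ≠ z →
      s.H z / 100 ≤ dist z a ∧ s.H a / 100 ≤ dist z a) :
    ∃ s' : CarvingState E, s'.U = s.U ∪ B ∧ (∀ c, c ∈ s'.C ↔ c ∈ s.C ∧ c ∉ B) ∧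
      (∀ a, a ∈ s'.Y ↔
        (a ∈ s.Y ∧ (a ∉ B ∨ ∃ y ∈ frontier B, dist a y ≤ s.H a / 10)) ∨ a ∈ N) ∧
      (∀ x, s.H x ≤ s'.H x) ∧ ∀ a ∈ s'.Y, s'.H a = s.H a := by
  classical
  set C' := s.C.filter (· ∉ B) with hC'
  set Y' := (s.Y.filter fun a => a ∉ B ∨ ∃ y ∈ frontier B, dist a y ≤ s.H a / 10) ∪ N with hY'
  have hC'm : ∀ c, c ∈ C' ↔ c ∈ s.C ∧ c ∉ B := fun c => Finset.mem_filter
  have hY'm : ∀ a, a ∈ Y' ↔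
      (a ∈ s.Y ∧ (a ∉ B ∨ ∃ y ∈ frontier B, dist a y ≤ s.H a / 10)) ∨ a ∈ N := fun a => by
    rw [hY', Finset.mem_union, Finset.mem_filter]
  obtain ⟨H', h1, h2, h3, h4⟩ := exists_scale_extension (C' ∪ Y') s.H s.lip s.nonneg
  have hCH : ∀ c ∈ C', H' c = s.H c := fun c hc => h3 c (Finset.mem_union_left _ hc)
  have hYH : ∀ a ∈ Y', H' a = s.H a := fun a ha => h3 a (Finset.mem_union_right _ ha)
  refine ⟨⟨s.U ∪ B, C', Y', H', h1, fun x => (s.nonneg x).trans (h2 x), ?_, ?_, ?_, ?_⟩, rfl, hC'm,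
    hY'm, h2, hYH⟩
  · intro c hc
    rw [hCH c hc]
    exact s.zero c ((hC'm c).1 hc).1
  · intro a ha
    rw [hYH a ha]
    rcases (hY'm a).1 ha with h | h
    exacts [s.pos a h.1, hpos a h]
  · intro u hu v hv hne
    rw [hYH u hu]
    rcases (hY'm u).1 hu with hu | hu <;> rcases (hY'm v).1 hv with hv | hv
    · exact s.sep u hu.1 v hv.1 hne
    · rw [dist_comm]
      exact (hsep v hv u (Or.inr hu.1) hne).2
    · exact (hsep u hu v (Or.inr hv.1) hne.symm).1
    · exact (hsep u hu v (Or.inl hv) hne.symm).1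
  · rintro ⟨a, ha⟩ x
    obtain ⟨b, hb, hd⟩ := h4 ⟨a, Finset.mem_union.2 ha⟩ x
    exact ⟨b, Finset.mem_union.1 hb, hd⟩

end CarvingState

/-- The constant in the bound for the number of boundary points of a carved ball. -/
noncomputable def boundaryConst (n : ℕ) : ℝ := 800 ^ n * (20 ^ n + 81 ^ n * n)

section Step

variable {E : Type*} [NormedAddCommGroup E] [NormedSpace ℝ E] [FiniteDimensional ℝ E]

/-- A maximal ρ-separated subset of A' has at most (2·40+1)^n points, and by minimality of ρ the
open ρ-ball around each contains at most m points of A. -/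
theorem card_le_of_minimal_ball {A : Finset E} {m : ℕ} {ρ : ℝ} (hρ : 0 < ρ)
    (hmin : ∀ a ∈ A, ∀ F ⊆ A, (∀ x ∈ F, dist x a < ρ) → F.card ≤ m) {c : E} {A' : Finset E}
    (hA' : A' ⊆ A) (hd : ∀ a ∈ A', dist a c ≤ 40 * ρ) :
    A'.card ≤ 81 ^ Module.finrank ℝ E * m := by
  classical
  obtain ⟨T, hTA, hsep, hnet⟩ := exists_separated_net A' ρ
  have h1 : T.card ≤ 81 ^ Module.finrank ℝ E := by
    have h2 := card_le_of_separated_of_dist_le (T := T) (w := c) (R := 40 * ρ) (by positivity) hρ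
      (fun z hz => hd z (hTA hz)) hsep
    have h3 : 2 * (40 * ρ) / ρ + 1 = 81 := by
      field_simp
      norm_num
    rw [h3] at h2
    exact_mod_cast h2
  have h2 : A' ⊆ T.biUnion fun a => A'.filter fun x => dist x a < ρ := by
    intro x hx
    rcases hnet x hx with h | ⟨a, ha, h⟩
    · exact Finset.mem_biUnion.2 ⟨x, h, Finset.mem_filter.2 ⟨hx, by simpa using hρ⟩⟩
    · exact Finset.mem_biUnion.2 ⟨a, ha, Finset.mem_filter.2 ⟨hx, h⟩⟩
  refine (Finset.card_le_card h2).trans ((Finset.card_biUnion_le_card_mul _ _ m ?_).trans ?_)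
  · intro a ha
    exact hmin a (hA' (hTA ha)) _ ((Finset.filter_subset _ _).trans hA')
      fun x hx => (Finset.mem_filter.1 hx).2
  · gcongr

/-- As long as many points are left, a ball can be carved out. -/
theorem CarvingState.exists_ball_step (s : CarvingState E) (hn : 1 ≤ Module.finrank ℝ E) {m : ℕ}
    {ν : ℝ} (hm : 2 ≤ m) (hν1 : 1 ≤ ν) (hνm : ν ^ Module.finrank ℝ E = m)
    (hν : 2 * boundaryConst (Module.finrank ℝ E) ≤ ν) (hs : m ≤ s.C.card + s.Y.card) :
    ∃ s' B N, IsCarvingStep (81 ^ Module.finrank ℝ E * m)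
      (2 * boundaryConst (Module.finrank ℝ E) / ν) s s' B N := by
  classical
  set n := Module.finrank ℝ E with hnE
  set A := s.C ∪ s.Y with hA
  have hAcard : A.card = s.C.card + s.Y.card := Finset.card_union_of_disjoint s.disjoint
  have hAm : ∀ a, a ∈ A ↔ a ∈ s.C ∨ a ∈ s.Y := fun a => Finset.mem_union
  obtain ⟨c, hcA, ρ, hρ, ⟨F, hFA, hFm, hF⟩, hmin⟩ := exists_minimal_ball hm (hAcard ▸ hs)
  have hAH : ∀ x, ∃ a ∈ A, dist x a ≤ s.H x := by
    intro x
    obtain ⟨a, ha, hd⟩ := s.near ⟨c, (hAm c).1 hcA⟩ x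
    exact ⟨a, (hAm a).2 ha, hd⟩
  have hcount : ∀ A' ⊆ A, (∀ a ∈ A', dist a c ≤ 40 * ρ) → A'.card ≤ 81 ^ n * m :=
    fun A' hA' hd => card_le_of_minimal_ball hρ hmin hA' hd
  -- The excluded radii are those of the spheres through original points.
  obtain ⟨t, ht1, ht2, htb, ht⟩ := exists_radius hn s.lip hAH hρ hν1 hcount
    (s.C.image fun x => dist x c)
  have ht0 : 0 < t := hρ.trans ht1
  have hfr : frontier (Metric.ball c t) = Metric.sphere c t := frontier_ball c ht0.ne'
  have hν0 : 0 < ν := by linarith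
  set β : ℝ := boundaryConst n * ν ^ (n - 1) with hβ
  have hνn : ν ^ (n - 1) * ν = m := by
    rw [← pow_succ, Nat.sub_add_cancel hn, hνm]
  have hβ' : 800 ^ n * (20 ^ n * ν ^ (n - 1) + ((81 ^ n * m : ℕ) : ℝ) * n / ν) = β := by
    rw [hβ, boundaryConst]
    push_cast
    rw [← hνn]
    field_simp
  have hβm : 2 * β ≤ m := by
    rw [← hνn, hβ]
    have : 0 ≤ ν ^ (n - 1) := by positivity
    nlinarith
  -- The ball contains a second point of A, and either an original point or the separation in `Y`
  -- bounds H(c). Hence all points near the sphere, at their own scale, lie well inside the ball of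
  -- radius 20ρ.
  have hHc : s.H c ≤ 100 * ρ := by
    obtain ⟨x, hx, hxc⟩ : ∃ x ∈ F, x ≠ c := by
      by_contra! hcon
      have h1 : F ⊆ {c} := fun x hx => Finset.mem_singleton.2 (hcon x hx)
      have h2 := Finset.card_le_card h1
      rw [Finset.card_singleton] at h2
      omega
    have hd := hF x hx
    rw [dist_comm] at hd
    rcases (hAm c).1 hcA with hc | hc
    · have := s.zero c hc
      linarith
    · rcases (hAm x).1 (hFA hx) with hx' | hx'
      · have h1 := s.zero x hx'
        have h2 := s.lip c x
        linarith
      · have := s.sep c hc x hx' hxc.symm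
        linarith
  have hTcard : ∀ T : Finset E, (∀ u ∈ T, 0 < s.H u) →
      (∀ u ∈ T, ∃ y ∈ Metric.sphere c t, dist u y ≤ s.H u / 10) →
      (∀ u ∈ T, ∀ v ∈ T, u ≠ v → s.H u / 100 ≤ dist u v) → (T.card : ℝ) ≤ β := by
    intro T hpos hnear hsep
    rw [← hβ']
    refine ht T hpos ?_ ?_ hsep
    · intro u hu
      obtain ⟨y, hy, hd⟩ := hnear u hu
      rw [Metric.mem_sphere] at hy
      have h1 := dist_triangle u y c
      have h2 := s.lip u c
      linarith
    · intro u hu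
      obtain ⟨y, hy, hd⟩ := hnear u hu
      rw [Metric.mem_sphere] at hy
      rw [← hy]
      exact (abs_dist_sub_le u y c).trans hd
  set W := s.Y.filter fun a => ∃ y ∈ Metric.sphere c t, dist a y ≤ s.H a / 10 with hW
  -- Any admissible N is separated together with `W`, so the radius bound applies to N ∪ W and a
  -- largest N exists.
  set Q : Finset E → Prop := fun N => (∀ z ∈ N, z ∈ Metric.sphere c t ∧ z ∉ s.U ∧ 0 < s.H z ∧
    z ∉ s.Y) ∧ ∀ z ∈ N, ∀ a, a ∈ N ∨ a ∈ s.Y → a ≠ z →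
      s.H z / 100 ≤ dist z a ∧ s.H a / 100 ≤ dist z a with hQ
  have hQcard : ∀ N, Q N → ((N.card + W.card : ℕ) : ℝ) ≤ β := by
    intro N hN
    rw [← Finset.card_union_of_disjoint (Finset.disjoint_left.2 fun z hz hzW =>
      (hN.1 z hz).2.2.2 (Finset.mem_filter.1 hzW).1)]
    refine hTcard _ ?_ ?_ ?_
    · intro u hu
      rcases Finset.mem_union.1 hu with hu | hu
      exacts [(hN.1 u hu).2.2.1, s.pos u (Finset.mem_filter.1 hu).1]
    · intro u hu
      rcases Finset.mem_union.1 hu with hu | hu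
      · refine ⟨u, (hN.1 u hu).1, ?_⟩
        rw [dist_self]
        have := s.nonneg u
        positivity
      · exact (Finset.mem_filter.1 hu).2
    · intro u hu v hv hne
      rcases Finset.mem_union.1 hu with hu | hu <;> rcases Finset.mem_union.1 hv with hv | hv
      · exact (hN.2 u hu v (Or.inl hv) hne.symm).1
      · exact (hN.2 u hu v (Or.inr (Finset.mem_filter.1 hv).1) hne.symm).1
      · rw [dist_comm]
        exact (hN.2 v hv u (Or.inr (Finset.mem_filter.1 hu).1) hne).2
      · exact s.sep u (Finset.mem_filter.1 hu).1 v (Finset.mem_filter.1 hv).1 hne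
  obtain ⟨N, hN, hNmax⟩ := exists_card_maximal Q (by simp [hQ]) ⌊β⌋₊ fun N hN => by
    refine Nat.le_floor (le_trans ?_ (hQcard N hN))
    push_cast
    linarith [(Nat.cast_nonneg W.card : (0 : ℝ) ≤ W.card)]
  obtain ⟨s', hU, hC', hY', hmono, hHeq⟩ := s.exists_next (Metric.ball c t) N
    (fun z hz => (hN.1 z hz).2.2.1) hN.2
  have hNW := hQcard N hN
  -- The points of F lie in the ball since ρ < t; of them only those in `W` survive.
  have hcard' : s'.C.card + s'.Y.card + m ≤ s.C.card + s.Y.card + (N.card + W.card) := by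
    have h1 : s'.C ∪ s'.Y ⊆ ((A \ F) ∪ W) ∪ N := by
      intro a ha
      rw [Finset.mem_union, hC', hY', hfr] at ha
      simp only [Finset.mem_union, Finset.mem_sdiff, hW, Finset.mem_filter]
      have hFB : a ∈ F → a ∈ Metric.ball c t := fun h => Metric.mem_ball.2 ((hF a h).trans_lt ht1)
      rcases ha with ⟨h, hB⟩ | ⟨h, hB | hB⟩ | h
      · exact Or.inl (Or.inl ⟨(hAm a).2 (Or.inl h), fun hf => hB (hFB hf)⟩)
      · exact Or.inl (Or.inl ⟨(hAm a).2 (Or.inr h), fun hf => hB (hFB hf)⟩)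
      · exact Or.inl (Or.inr ⟨h, hB⟩)
      · exact Or.inr h
    have h2 := Finset.card_le_card h1
    have h3 := Finset.card_union_le ((A \ F) ∪ W) N
    have h4 := Finset.card_union_le (A \ F) W
    have h5 := Finset.card_sdiff_add_card_eq_card hFA
    rw [Finset.card_union_of_disjoint s'.disjoint] at h2
    omega
  have hcardR : ((s'.C.card + s'.Y.card : ℕ) : ℝ) + m ≤ (s.C.card + s.Y.card : ℕ) + β := by
    have : ((s'.C.card + s'.Y.card + m : ℕ) : ℝ) ≤
        ((s.C.card + s.Y.card + (N.card + W.card) : ℕ) : ℝ) := by exact_mod_cast hcard'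
    rw [Nat.cast_add _ m, Nat.cast_add _ (N.card + W.card)] at this
    linarith
  refine ⟨s', Metric.ball c t, N, ⟨Metric.isOpen_ball, ?_, hC', hY', hU, ?_,
    fun z hz => (hN.1 z hz).2.1, fun z hz => (hN.1 z hz).2.2.1, hN.2, ?_, hmono, hHeq, ?_, ?_, ?_⟩⟩
  · intro x hx hxf
    rw [hfr, Metric.mem_sphere] at hxf
    exact htb (Finset.mem_image.2 ⟨x, hx, hxf⟩)
  · intro z hz
    rw [hfr]
    exact (hN.1 z hz).1
  · intro y hy hyU
    rw [hfr] at hy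
    by_cases hyNY : y ∈ N ∨ y ∈ s.Y
    · refine ⟨y, hyNY, ?_⟩
      rw [dist_self]
      have := s.nonneg y
      positivity
    push Not at hyNY
    have hypos : 0 < s.H y := by
      refine lt_of_le_of_ne (s.nonneg y) fun h0 => ?_
      obtain ⟨a, ha, hd⟩ := hAH y
      rw [← h0] at hd
      have hya := dist_le_zero.1 hd
      subst hya
      rcases (hAm y).1 ha with ha | ha
      · exact htb (Finset.mem_image.2 ⟨y, ha, hy⟩)
      · exact hyNY.2 ha
    -- Otherwise y could be added to N: if H(y)/50 < dist y w, then H(w) < 51 dist y w by the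
    -- Lipschitz property.
    by_contra! hcon
    have hfar : ∀ w, w ∈ N ∨ w ∈ s.Y → s.H y / 100 ≤ dist y w ∧ s.H w / 100 ≤ dist y w := by
      intro w hw
      have h1 := hcon w hw
      have h2 := s.lip w y
      rw [dist_comm] at h2
      constructor <;> linarith
    have := hNmax (insert y N) ⟨?_, ?_⟩
    · rw [Finset.card_insert_of_notMem hyNY.1] at this
      omega
    · intro z hz
      rcases Finset.mem_insert.1 hz with rfl | hz
      exacts [⟨hy, hyU, hypos, hyNY.2⟩, hN.1 z hz]
    · intro z hz a ha hne
      rcases Finset.mem_insert.1 hz with rfl | hzN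
      · refine hfar a ?_
        rcases ha with ha | ha
        · exact Or.inl (Finset.mem_of_mem_insert_of_ne ha hne)
        · exact Or.inr ha
      · by_cases hay : a = y
        · subst hay
          rw [dist_comm]
          exact (hfar z (Or.inl hzN)).symm
        · refine hN.2 z hzN a ?_ hne
          rcases ha with ha | ha
          · exact Or.inl (Finset.mem_of_mem_insert_of_ne ha hay)
          · exact Or.inr ha
  · intro G hG hGB
    refine hcount G (hG.trans Finset.subset_union_left) fun a ha => ?_
    have := Metric.mem_ball.1 (hGB a ha)
    linarith
  · intro W' hW' hnear
    rw [hfr] at hnear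
    have h1 : W' ⊆ W := fun a ha => Finset.mem_filter.2 ⟨hW' ha, hnear a ha⟩
    have h2 : ((N.card + W'.card : ℕ) : ℝ) ≤ β := by
      refine le_trans ?_ hNW
      exact_mod_cast Nat.add_le_add_left (Finset.card_le_card h1) _
    refine h2.trans ?_
    have h3 : β = 2 * boundaryConst n / ν * (m / 2) := by
      rw [hβ, ← hνn]
      field_simp
    have h4 : 0 ≤ 2 * boundaryConst n / ν := by
      unfold boundaryConst
      positivity
    rw [h3]
    gcongr
    linarith
  · have h1 : ((N.card + W.card : ℕ) : ℝ) + (N.card + W.card : ℕ) ≤ m := by linarith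
    have h2 : N.card + W.card + (N.card + W.card) ≤ m := by exact_mod_cast h1
    omega

end Step

/-! ### Iterating the steps and choosing the constants -/

open Classical in
/-- A division with few boundary points gives rise to a weak division. -/
theorem IsClosedDivision.exists_isWeakRDivision {d r : ℕ} (hr : 1 ≤ r)
    {C Z : Finset (EuclideanSpace ℝ (Fin d))} {𝓡 : Finset (Finset (EuclideanSpace ℝ (Fin d)))}
    (h : IsClosedDivision r C Z 𝓡) (hrC : r ≤ C.card) {c₂ : ℝ} (hc₂ : 0 ≤ c₂)
    (hb : ((∑ R ∈ 𝓡, (R ∩ Z).card : ℕ) : ℝ) ≤ c₂ * C.card / (r : ℝ) ^ ((1 : ℝ) / d)) :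
    ∃ 𝓡', IsWeakRDivision (3 + 2 * c₂) c₂ r C Z 𝓡' := by
  obtain ⟨𝓡', h', hle, hcard⟩ := h.exists_card_mul_le
  have hb' : ((∑ R ∈ 𝓡', (R ∩ Z).card : ℕ) : ℝ) ≤ c₂ * C.card / (r : ℝ) ^ ((1 : ℝ) / d) :=
    le_trans (by exact_mod_cast hle) hb
  have hr' : (1 : ℝ) ≤ r := by exact_mod_cast hr
  have hpow : (1 : ℝ) ≤ (r : ℝ) ^ ((1 : ℝ) / d) := Real.one_le_rpow hr' (by positivity)
  refine ⟨𝓡', ⟨h'.subset, h'.nonempty, h'.disjoint, h'.union, ?_, h'.card_region, hb',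
    fun R hR => h'.separator hR⟩⟩
  rw [le_div_iff₀ (by linarith)]
  rw [h'.sum_card] at hcard
  have h1 : (𝓡'.card : ℝ) * r ≤ 2 * (C.card + (∑ R ∈ 𝓡', (R ∩ Z).card : ℕ)) + r := by
    exact_mod_cast hcard
  have h2 : c₂ * C.card / (r : ℝ) ^ ((1 : ℝ) / d) ≤ c₂ * C.card :=
    div_le_self (by positivity) hpow
  have h3 : (r : ℝ) ≤ C.card := by exact_mod_cast hrC
  linarith

/-- Carving steps can be repeated until no points are left. -/
theorem exists_isCarving {E : Type*} [NormedAddCommGroup E] {P : ℕ} {γ : ℝ} (hγ : 0 ≤ γ)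
    (hstep : ∀ s : CarvingState E, ∃ s' B N, IsCarvingStep P γ s s' B N) (C₀ : Finset E) :
    ∃ B C Y N H, IsCarving B C Y N H ∧ C 0 = C₀ ∧ (∀ j ≥ C₀.card, C j = ∅ ∧ N j = ∅) ∧
      (∀ j, ∀ F ⊆ C j, (∀ c ∈ F, c ∈ B j) → F.card ≤ P) ∧
      ∀ J, ((∑ j ∈ Finset.range J, ((N j).card + (IsCarving.nearPoints B Y H j).card) : ℕ) : ℝ) ≤
        γ * C₀.card := by
  classical
  choose next B N hnext using hstep
  obtain ⟨H₀, hl, hn, he, hd⟩ := exists_scale_extension C₀ (fun _ => 0)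
    (fun x y => by simp) fun _ => le_rfl
  let s₀ : CarvingState E := ⟨∅, C₀, ∅, H₀, hl, hn, fun c hc => (he c hc).le, by simp, by simp,
    fun ⟨a, ha⟩ x => by
      obtain ⟨b, hb, hxb⟩ := hd ⟨a, by simpa using ha⟩ x
      exact ⟨b, Or.inl hb, hxb⟩⟩
  let st : ℕ → CarvingState E := fun j => Nat.rec s₀ (fun _ s => next s) j
  have hst : ∀ j, IsCarvingStep P γ (st j) (st (j + 1)) (B (st j)) (N (st j)) :=
    fun j => hnext (st j)
  have hU : ∀ j x, x ∈ (st j).U ↔ ∃ l < j, x ∈ B (st l) := by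
    intro j
    induction j with
    | zero => exact fun x => ⟨fun h => h.elim, fun ⟨l, hl, _⟩ => absurd hl (by omega)⟩
    | succ j ih =>
      intro x
      rw [(hst j).U_succ, Set.mem_union, ih]
      constructor
      · rintro (⟨l, hl, hx⟩ | hx)
        exacts [⟨l, by omega, hx⟩, ⟨j, by omega, hx⟩]
      · rintro ⟨l, hl, hx⟩
        rcases (Nat.lt_succ_iff_lt_or_eq.1 hl) with hl | rfl
        exacts [Or.inl ⟨l, hl, hx⟩, Or.inr hx]
  -- The subtraction in `decrease` is truncated, so steps can be taken forever, but after |C₀| of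
  -- them no point is left.
  have hcard : ∀ j, (st j).C.card + (st j).Y.card ≤ C₀.card - j := by
    intro j
    induction j with
    | zero => exact (Nat.add_zero _).le
    | succ j ih =>
      have := (hst j).decrease
      omega
  have hsum : ∀ J, ((∑ j ∈ Finset.range J, ((N (st j)).card + (IsCarving.nearPoints
      (fun j => B (st j)) (fun j => (st j).Y) (fun j => (st j).H) j).card) : ℕ) : ℝ) ≤
        γ * (C₀.card - ((st J).C.card + (st J).Y.card : ℕ)) := by
    intro J
    induction J with
    | zero =>
      have : (st 0).C.card + (st 0).Y.card = C₀.card := Nat.add_zero _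
      rw [this]
      simp
    | succ J ih =>
      rw [Finset.sum_range_succ, Nat.cast_add]
      have := (hst J).card_boundary (IsCarving.nearPoints
        (fun j => B (st j)) (fun j => (st j).Y) (fun j => (st j).H) J) (Finset.filter_subset _ _)
        (fun a ha => (Finset.mem_filter.1 ha).2)
      linarith
  refine ⟨fun j => B (st j), fun j => (st j).C, fun j => (st j).Y, fun j => N (st j),
    fun j => (st j).H, ⟨fun j => (hst j).isOpen, fun j => (hst j).C_frontier,
      fun j => (hst j).C_succ, rfl, fun j => (hst j).Y_succ, fun j => (hst j).N_frontier, ?_,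
      fun j => (hst j).N_pos, fun j => (hst j).N_sep, ?_, fun j => (st j).lip,
      fun j => (hst j).mono, fun j => (st j).zero, fun j => (hst j).H_eq⟩, rfl, ?_,
    fun j => (hst j).card_C, ?_⟩
  · intro j z hz l hl hzl
    exact (hst j).N_out z hz ((hU j z).2 ⟨l, hl, hzl⟩)
  · intro j y hy hout
    refine (hst j).cover y hy fun hyU => ?_
    obtain ⟨l, hl, hyl⟩ := (hU j y).1 hyU
    exact hout l hl hyl
  · intro j hj
    have h1 := hcard j
    have h2 := hcard (j + 1)
    constructor
    · have h3 : (st j).C.card = 0 := by omega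
      exact Finset.card_eq_zero.1 h3
    · refine Finset.eq_empty_of_forall_notMem fun a ha => ?_
      have h3 : a ∈ (st (j + 1)).Y := ((hst j).Y_succ a).2 (Or.inr ha)
      have := Finset.card_pos.2 ⟨a, h3⟩
      omega
  · intro J
    refine (hsum J).trans (mul_le_mul_of_nonneg_left ?_ hγ)
    linarith [(Nat.cast_nonneg ((st J).C.card + (st J).Y.card) : (0 : ℝ) ≤ _)]

open Classical in
/-- If steps with few boundary points exist, there is a division with few boundary points. -/
theorem exists_isClosedDivision_of_step {d r P : ℕ} (hd : 1 ≤ d) (hr : d + 2 ≤ r)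
    (hP : 2 * P ≤ r) {γ : ℝ} (hγ : 0 ≤ γ)
    (hstep : ∀ s : CarvingState (EuclideanSpace ℝ (Fin d)), ∃ s' B N, IsCarvingStep P γ s s' B N)
    (C₀ : Finset (EuclideanSpace ℝ (Fin d))) :
    ∃ Z 𝓡, IsClosedDivision r C₀ Z 𝓡 ∧ ((∑ R ∈ 𝓡, (R ∩ Z).card : ℕ) : ℝ) ≤
      2 * (d + 2) * (1 + 12 ^ d) * γ * C₀.card := by
  obtain ⟨B, C, Y, N, H, h, hC0, hlate, hCP, hsum⟩ := exists_isCarving hγ hstep C₀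
  set J := C₀.card with hJ
  have hCJ : ∀ j, ∀ c ∈ C j, j < J := by
    intro j c hc
    by_contra hj
    rw [(hlate j (not_lt.1 hj)).1] at hc
    simp at hc
  have hpiece : ∀ c, ∃ j, c ∈ C₀ → c ∈ C j ∧ c ∈ B j := by
    intro c
    by_cases hc : c ∈ C₀
    · by_contra! hcon
      have hall : ∀ j, c ∈ C j := by
        intro j
        induction j with
        | zero => exact hC0 ▸ hc
        | succ j ih => exact (h.C_succ j c).2 ⟨ih, (hcon j).2 ih⟩
      exact absurd (hCJ J c (hall J)) (lt_irrefl _)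
    · exact ⟨0, fun h => absurd h hc⟩
  choose f hf using hpiece
  set Z := (Finset.range J).biUnion N with hZdef
  have hZ : ∀ j, N j ⊆ Z := by
    intro j z hz
    refine Finset.mem_biUnion.2 ⟨j, Finset.mem_range.2 ?_, hz⟩
    by_contra hj
    rw [(hlate j (not_lt.1 hj)).2] at hz
    simp at hz
  have hZN : ∀ z ∈ Z, ∃ i, z ∈ N i := by
    intro z hz
    obtain ⟨i, -, hi⟩ := Finset.mem_biUnion.1 hz
    exact ⟨i, hi⟩
  have hCZ : Disjoint C₀ Z := by
    rw [Finset.disjoint_left]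
    intro c hc hcZ
    obtain ⟨j, hj⟩ := hZN c hcZ
    obtain ⟨h1, h2⟩ := hf c hc
    rcases lt_or_ge (f c) j with hlt | hge
    · exact h.N_out j c hj _ hlt h2
    · exact absurd (h.zero j c (h.C_anti hge h1)) (not_le.2 (h.N_pos j c hj))
  have hδ : ∀ q : ℕ × EuclideanSpace ℝ (Fin d), ∃ δ : ℝ, 0 < δ ∧
      (q.2 ∉ frontier (B q.1) → ∀ y ∈ frontier (B q.1), δ ≤ dist y q.2) := by
    intro q
    by_cases hq : q.2 ∈ frontier (B q.1)
    · exact ⟨1, one_pos, fun h => absurd hq h⟩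
    · obtain ⟨δ, hδ, hball⟩ := Metric.isOpen_iff.1 (isClosed_frontier (s := B q.1)).isOpen_compl q.2 hq
      refine ⟨δ, hδ, fun _ y hy => ?_⟩
      by_contra hlt
      exact hball (Metric.mem_ball.2 (not_le.1 hlt)) hy
  choose δ hδ0 hδ using hδ
  obtain ⟨τ, hτ, hτδ⟩ := (Finset.range J ×ˢ C₀).exists_pos_forall_le δ fun q _ => hδ0 q
  have hτF : ∀ k, ∀ c ∈ C k, ∀ y ∈ frontier (B k), 2 * (τ / 2) ≤ dist y c := by
    intro k c hc y hy
    have h1 := hτδ (k, c) (Finset.mk_mem_product (Finset.mem_range.2 (hCJ k c hc))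
      (hC0 ▸ h.C_anti (Nat.zero_le k) hc))
    have h2 := hδ (k, c) (h.C_frontier k c hc) y hy
    dsimp only at h2
    linarith
  set Q : ℕ → ℕ := fun j => (touchingPoints f C₀ Z j).card with hQ
  obtain ⟨good, hgood⟩ : ∃ good : ℕ → Prop, ∀ j, good j ↔ (C₀.filter (f · = j)).card + Q j ≤ r :=
    ⟨_, fun _ => Iff.rfl⟩
  obtain ⟨Z', 𝓡, hdiv, hle⟩ := exists_isClosedDivision_of_classes hd hr hCZ f (half_pos hτ)
    (fun p hp c hc hne z hzc x hx => h.exists_dist_lt hZ (half_pos hτ) hτF (Ne.symm hne)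
      (hf p hp).1 (hf p hp).2 (hf c hc).1 (hf c hc).2 hzc hx) good (fun j hj => (hgood j).1 hj)
  refine ⟨Z', 𝓡, hdiv, ?_⟩
  have hfJ : C₀.image f ⊆ Finset.range J := by
    intro j hj
    obtain ⟨c, hc, rfl⟩ := Finset.mem_image.1 hj
    exact Finset.mem_range.2 (hCJ _ c (hf c hc).1)
  have hgoodsum : ∑ j ∈ (C₀.image f).filter good, Q j ≤ ∑ j ∈ Finset.range J, Q j :=
    Finset.sum_le_sum_of_subset ((Finset.filter_subset _ _).trans hfJ)
  -- A bad class has at most P ≤ r/2 points but exceeds r with its touching points, so the latter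
  -- outnumber it.
  have hbadsum : (C₀.filter fun c => ¬ good (f c)).card ≤ ∑ j ∈ Finset.range J, Q j := by
    rw [Finset.card_eq_sum_card_fiberwise (f := f) (t := Finset.range J) (fun c hc =>
      hfJ (Finset.mem_image_of_mem f (Finset.mem_filter.1 hc).1))]
    refine Finset.sum_le_sum fun j _ => ?_
    by_cases hj : good j
    · refine le_of_eq_of_le ?_ (Nat.zero_le _)
      refine Finset.card_eq_zero.2 (Finset.eq_empty_of_forall_notMem fun c hc => ?_)
      obtain ⟨hc1, hc2⟩ := Finset.mem_filter.1 hc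
      exact (Finset.mem_filter.1 hc1).2 (hc2 ▸ hj)
    · have h1 : (C₀.filter (f · = j)).card ≤ P := by
        refine hCP j _ (fun c hc => ?_) fun c hc => ?_ <;>
        · obtain ⟨hc1, rfl⟩ := Finset.mem_filter.1 hc
          first
          | exact (hf c hc1).1
          | exact (hf c hc1).2
      have h2 : ((C₀.filter fun c => ¬ good (f c)).filter (f · = j)).card ≤
          (C₀.filter (f · = j)).card :=
        Finset.card_le_card (Finset.filter_subset_filter _ (Finset.filter_subset _ _))
      have h3 : r < (C₀.filter (f · = j)).card + Q j := not_le.1 fun h => hj ((hgood j).2 h)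
      omega
  have hQsum : ∑ j ∈ Finset.range J, Q j ≤ (1 + 12 ^ d) *
      (2 * ∑ j ∈ Finset.range J, ((N j).card + (IsCarving.nearPoints B Y H j).card)) := by
    have h1 : ∑ j ∈ Finset.range J, Q j ≤
        (1 + 12 ^ d) * ∑ j ∈ Finset.range J, (IsCarving.boundaryPoints B Y N H j).card := by
      rw [Finset.mul_sum]
      refine Finset.sum_le_sum fun j _ => ?_
      have := h.card_touchingPoints_le hZ hZN (C₀ := C₀) (f := f) (fun c hc => hf c hc) j
      rwa [finrank_euclideanSpace_fin] at this
    exact h1.trans (Nat.mul_le_mul_left _ (h.sum_card_boundaryPoints_le J))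
  have htotal : ∑ R ∈ 𝓡, (R ∩ Z').card ≤ (d + 2) * ((1 + 12 ^ d) *
      (2 * ∑ j ∈ Finset.range J, ((N j).card + (IsCarving.nearPoints B Y H j).card))) := by
    refine (hle.trans ?_).trans (Nat.mul_le_mul_left _ hQsum)
    calc _ ≤ ∑ j ∈ Finset.range J, Q j + (∑ j ∈ Finset.range J, Q j) * (d + 1) :=
          Nat.add_le_add hgoodsum (Nat.mul_le_mul_right _ hbadsum)
      _ = _ := by ring
  calc ((∑ R ∈ 𝓡, (R ∩ Z').card : ℕ) : ℝ) ≤ (((d + 2) * ((1 + 12 ^ d) * (2 * ∑ j ∈ Finset.range J,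
        ((N j).card + (IsCarving.nearPoints B Y H j).card))) : ℕ) : ℝ) := by exact_mod_cast htotal
    _ = 2 * (d + 2) * (1 + 12 ^ d) * ((∑ j ∈ Finset.range J,
        ((N j).card + (IsCarving.nearPoints B Y H j).card) : ℕ) : ℝ) := by
      push_cast
      ring
    _ ≤ 2 * (d + 2) * (1 + 12 ^ d) * (γ * J) := by
      gcongr
      exact hsum J
    _ = _ := by ring

open Classical in
/-- All points can be isolated by small simplices. -/
theorem exists_isClosedDivision_singletons {d r : ℕ} (hd : 1 ≤ d) (hr : d + 2 ≤ r)
    (C : Finset (EuclideanSpace ℝ (Fin d))) :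
    ∃ Z 𝓡, IsClosedDivision r C Z 𝓡 ∧ ∑ R ∈ 𝓡, (R ∩ Z).card ≤ C.card * (d + 1) := by
  obtain ⟨Z, 𝓡, h, hle⟩ := exists_isClosedDivision_of_classes hd hr (Finset.disjoint_empty_right C)
    (fun _ => 0) one_pos (fun _ _ _ _ hne => absurd rfl hne) (fun _ => False) (fun _ h => h.elim)
  exact ⟨Z, 𝓡, h, by simpa using hle⟩

open Classical in
/-- If `r` is large, there are divisions with few boundary points. -/
theorem exists_isClosedDivision_of_large {d : ℕ} (hd : 1 ≤ d) :
    ∃ r₀ : ℕ, ∃ c : ℝ, 0 ≤ c ∧ ∀ r : ℕ, d + 2 ≤ r → r₀ ≤ r →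
      ∀ C : Finset (EuclideanSpace ℝ (Fin d)), ∃ Z 𝓡, IsClosedDivision r C Z 𝓡 ∧
        ((∑ R ∈ 𝓡, (R ∩ Z).card : ℕ) : ℝ) ≤ c * C.card / (r : ℝ) ^ ((1 : ℝ) / d) := by
  have hK : 0 ≤ boundaryConst d := by
    unfold boundaryConst
    positivity
  set m₀ : ℕ := ⌈(2 * boundaryConst d) ^ d⌉₊ + 2 with hm₀
  set L : ℕ := 81 ^ d with hL
  have hL0 : 0 < L := by positivity
  refine ⟨2 * L * m₀, 2 * (d + 2) * (1 + 12 ^ d) * (2 * boundaryConst d * 324), by positivity,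
    fun r hr hr₀ C => ?_⟩
  -- This makes the bound L·m for the size of a piece at most r/2.
  set m := r / (2 * L) with hm
  have hmm₀ : m₀ ≤ m := by
    rw [hm, Nat.le_div_iff_mul_le (by positivity)]
    linarith
  have hmr : m * (2 * L) ≤ r := Nat.div_mul_le_self _ _
  have hrm : r < (m + 1) * (2 * L) := by
    rw [mul_comm]
    exact Nat.lt_mul_div_succ _ (by positivity)
  set ν : ℝ := (m : ℝ) ^ ((1 : ℝ) / d) with hν
  have hm1 : (1 : ℝ) ≤ m := by exact_mod_cast (by omega : 1 ≤ m)
  have hν1 : 1 ≤ ν := Real.one_le_rpow hm1 (by positivity)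
  have hνm : ν ^ d = m := by
    rw [hν, one_div, Real.rpow_inv_natCast_pow (by positivity) (by omega)]
  have hν2 : 2 * boundaryConst d ≤ ν := by
    refine le_of_pow_le_pow_left₀ (by omega : d ≠ 0) (by positivity) ?_
    rw [hνm]
    refine (Nat.le_ceil _).trans ?_
    exact_mod_cast (by omega : ⌈(2 * boundaryConst d) ^ d⌉₊ ≤ m)
  -- Here 324 = 4·81, from r < 2L(m+1) ≤ 4Lm ≤ 4^d · 81^d · m.
  have hrν : (r : ℝ) ^ ((1 : ℝ) / d) ≤ 324 * ν := by
    refine le_of_pow_le_pow_left₀ (by omega : d ≠ 0) (by positivity) ?_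
    rw [one_div, Real.rpow_inv_natCast_pow (by positivity) (by omega), mul_pow, hνm]
    have h1 : r ≤ 4 ^ d * L * m := by
      have h2 : 4 ≤ 4 ^ d := Nat.le_self_pow (by omega) 4
      have h3 : 1 ≤ m := by omega
      nlinarith [Nat.mul_le_mul_right (L * m) h2, Nat.mul_le_mul_right L h3]
    have h2 : (4 : ℕ) ^ d * L = 324 ^ d := by
      rw [hL, ← mul_pow]
      norm_num
    rw [h2] at h1
    exact_mod_cast h1
  have hstep : ∀ s : CarvingState (EuclideanSpace ℝ (Fin d)), ∃ s' B N,
      IsCarvingStep (L * m) (2 * boundaryConst d / ν) s s' B N := by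
    intro s
    rcases le_or_gt m (s.C.card + s.Y.card) with h | h
    · have := s.exists_ball_step (m := m) (ν := ν)
      rw [finrank_euclideanSpace_fin] at this
      exact this hd (by omega) hν1 hνm hν2 h
    · exact s.exists_last_step (by positivity) (h.le.trans (Nat.le_mul_of_pos_left m hL0))
  obtain ⟨Z, 𝓡, h, hle⟩ := exists_isClosedDivision_of_step hd hr (P := L * m) (by linarith)
    (by positivity) hstep C
  refine ⟨Z, 𝓡, h, hle.trans ?_⟩
  have hr0 : (0 : ℝ) < (r : ℝ) ^ ((1 : ℝ) / d) :=
    Real.rpow_pos_of_pos (by exact_mod_cast (by omega : 0 < r)) _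
  have h1 : 2 * boundaryConst d / ν ≤ 2 * boundaryConst d * 324 / (r : ℝ) ^ ((1 : ℝ) / d) := by
    rw [div_le_div_iff₀ (by linarith) hr0, mul_assoc _ 324]
    gcongr
  calc _ ≤ 2 * (d + 2) * (1 + 12 ^ d) *
        (2 * boundaryConst d * 324 / (r : ℝ) ^ ((1 : ℝ) / d)) * C.card := by gcongr
    _ = _ := by ring

theorem mainTheorem5 (d : ℕ) (hd : 1 ≤ d) :
    ∃ c₁ c₂ : ℝ, ∀ r : ℕ, d + 2 ≤ r →
      ∀ C : Finset (EuclideanSpace ℝ (Fin d)), r ≤ C.card →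
        ∃ (Z : Finset (EuclideanSpace ℝ (Fin d)))
          (𝓡 : Finset (Finset (EuclideanSpace ℝ (Fin d)))),
          IsWeakRDivision c₁ c₂ r C Z 𝓡 := by
  classical
  obtain ⟨r₀, c, hc, hlarge⟩ := exists_isClosedDivision_of_large hd
  -- The second entry serves r < r₀, where r^(1/d) ≤ r₀ and d+1 boundary points per point of C are
  -- affordable.
  set c₂ : ℝ := max c ((d + 1) * r₀) with hc₂
  have hc₂0 : 0 ≤ c₂ := hc.trans (le_max_left _ _)
  refine ⟨3 + 2 * c₂, c₂, fun r hr C hrC => ?_⟩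
  have hr1 : (1 : ℝ) ≤ r := by exact_mod_cast (by omega : 1 ≤ r)
  have hr0 : (0 : ℝ) < (r : ℝ) ^ ((1 : ℝ) / d) := Real.rpow_pos_of_pos (by linarith) _
  rcases le_or_gt r₀ r with hrr | hrr
  · obtain ⟨Z, 𝓡, h, hle⟩ := hlarge r hr hrr C
    obtain ⟨𝓡', h'⟩ := h.exists_isWeakRDivision (by omega) hrC hc₂0 (hle.trans (by
      gcongr
      exact le_max_left _ _))
    exact ⟨Z, 𝓡', h'⟩
  · obtain ⟨Z, 𝓡, h, hle⟩ := exists_isClosedDivision_singletons hd hr C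
    have hle' : ((∑ R ∈ 𝓡, (R ∩ Z).card : ℕ) : ℝ) ≤ C.card * (d + 1) := by exact_mod_cast hle
    obtain ⟨𝓡', h'⟩ := h.exists_isWeakRDivision (by omega) hrC hc₂0 (hle'.trans (by
      rw [le_div_iff₀ hr0]
      have h1 : (r : ℝ) ^ ((1 : ℝ) / d) ≤ r₀ := by
        refine (Real.rpow_le_self_of_one_le hr1 ?_).trans (by exact_mod_cast hrr.le)
        rw [div_le_one (by positivity)]
        exact_mod_cast hd
      calc (C.card : ℝ) * (d + 1) * (r : ℝ) ^ ((1 : ℝ) / d) ≤ C.card * (d + 1) * r₀ := by gcongr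
        _ = (d + 1) * r₀ * C.card := by ring
        _ ≤ c₂ * C.card := by
          gcongr
          exact le_max_right _ _))
    exact ⟨Z, 𝓡', h'⟩
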